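/- Let $\hbar>0$ and let $\sigma,\gamma$ be nonzero real numbers. For $\eta\in\mathbb R$ put $\omega=\sigma\gamma\eta$ and $$H(\xi,p)=-\tfrac{i}{2}\bigl(\sigma^2\xi^2+\gamma^2\eta^2p^2\bigr)-\eta p ,$$ and for $\eta\neq0$ and $t,\xi,p\in\mathbb R$ put $$A(t,\xi,p)=\frac{1}{\cosh(t\omega/2)}\,\exp\Bigl(-\frac{1}{2\gamma^2\hbar}\Bigl[t-\frac{2\tanh(t\omega/2)}{\omega}\Bigr]\Bigr)\exp\Bigl(-\frac{i}{\hbar}\,\frac{2\tanh(t\omega/2)}{\omega}\,H(\xi,p)\Bigr);$$ for $\eta=0$ put $A(t,\xi,p)=\exp\bigl(-\sigma^2t\,\xi^2/(2\hbar)\bigr)$. Then the following hold. 1. $A$ is jointly continuous in $(\eta,t,\xi,p)\in\mathbb R^4$; that is, the formula for $\eta\ne0$ extends continuously to $\eta=0$, with the value given there. 2. For every $\eta\in\mathbb R$, $A$ is $C^\infty$ in $(t,\xi,p)\in\mathbb R^3$, $A(0,\xi,p)=1$, and $i\hbar\,\partial_tA=H\#A$ for all $t,\xi,p\in\mathbb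 R$, where $\#$ is the Weyl product $$a\#b=\sum_{n\ge0}\frac{(i\hbar)^n}{2^n\,n!}\;a\,\bigl(\overleftarrow{\partial_p}\,\overrightarrow{\partial_\xi}-\overleftarrow{\partial_\xi}\,\overrightarrow{\partial_p}\bigr)^n\,b$$ (a finite sum when $a=H$). 3. For every $\eta\in\mathbb R$ and $t>0$ the Weyl quantisation of $A$ has the kernel $$K(t,p,p')=\frac{1}{2\pi\hbar}\int_{\mathbb R}e^{\frac{i}{\hbar}(p-p')\xi}A\Bigl(t,\xi,\frac{p+p'}{2}\Bigr)\,d\xi ,$$ the integral being absolutely convergent, and $K$ is the propagator of the transformed Lindblad equation $$i\hbar\,\partial_tw=-i\Bigl[-\frac{\hbar^2\sigma^2}{2}\partial_p^2w+\frac{\gamma^2\eta^2}{2}p^2w\Bigr]-\eta p\,w ,\qquad t>0,\ p\in\mathbb R,$$ in the following sense. For every $1\le r<\infty$ and every $w_0\in L^r(\mathbb R)$, the absolutely convergent integral $w(t,p)=\int_{\mathbb R} K(t,p,p')\,w_0(p')\,dp'$ is the unique solution with initial value $w_0$. Here a solution with initial value $w_0$ is a function on $(0,\infty)\times\mathbb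 R$ of class $C^{1,2}$ (that is, $w,\partial_tw,\partial_pw,\partial_p^2w$ exist and are continuous) which satisfies the equation pointwise, has $\sup_{0<t\le T}\|w(t,\cdot)\|_{L^r}<\infty$ for every $T>0$, and satisfies $w(t,\cdot)\to w_0$ in $L^r$ as $t\to0^+$. -/

import Mathlib

open MeasureTheory Filter Topology
open scoped NNReal ContDiff

noncomputable section

namespace LindbladMehler

/-- The complex quadratic Hamilton function
`H(ξ, p) = -(i/2) (σ² ξ² + γ² η² p²) - η p`. -/
def hamiltonian (σ γ η ξ p : ℝ) : ℂ :=
  -(Complex.I / 2) * ((σ ^ 2 * ξ ^ 2 + γ ^ 2 * η ^ 2 * p ^ 2 : ℝ) : ℂ) - ((η * p : ℝ) : ℂ)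

/-- The explicit symbol for `η ≠ 0`, with `ω = σ γ η`:
`cosh(tω/2)⁻¹ exp(-(1/(2γ²ħ)) [t - 2 tanh(tω/2)/ω]) exp(-(i/ħ) (2 tanh(tω/2)/ω) H(ξ, p))`. -/
def symbolFormula (ħ σ γ η t ξ p : ℝ) : ℂ :=
  let om : ℝ := σ * γ * η
  let τ : ℝ := 2 * Real.tanh (t * om / 2) / om
  (((Real.cosh (t * om / 2))⁻¹ : ℝ) : ℂ)
    * Complex.exp ((-(1 / (2 * γ ^ 2 * ħ)) * (t - τ) : ℝ) : ℂ)
    * Complex.exp (-(Complex.I / (ħ : ℂ)) * (τ : ℂ) * hamiltonian σ γ η ξ p)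

/-- The symbol for all real `η`: the explicit formula for `η ≠ 0`, and the Gaussian
`exp(-σ² t ξ² / (2ħ))` for `η = 0`. -/
def propagatorSymbol (ħ σ γ η t ξ p : ℝ) : ℂ :=
  if η = 0 then Complex.exp ((-(σ ^ 2 * t * ξ ^ 2) / (2 * ħ) : ℝ) : ℂ)
  else symbolFormula ħ σ γ η t ξ p

/-- Partial derivative in the momentum variable `ξ` of a function of `(ξ, p)`. -/
def partialXi (a : ℝ → ℝ → ℂ) : ℝ → ℝ → ℂ := fun ξ p => deriv (fun x => a x p) ξ

/-- Partial derivative in the position variable `p` of a function of `(ξ, p)`. -/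
def partialP (a : ℝ → ℝ → ℂ) : ℝ → ℝ → ℂ := fun ξ p => deriv (fun y => a ξ y) p

/-- The `n`-th term `((iħ)ⁿ / (2ⁿ n!)) a (∇← · Ω ∇→)ⁿ b` of the Weyl (Moyal) product `a # b`.
On the phase space with coordinates `(ξ, p)` and `Ω = (0, -1; 1, 0)` the bidifferential operator
is `∇← · Ω ∇→ = ∂←_p ∂→_ξ - ∂←_ξ ∂→_p`, and its `n`-th power is expanded binomially. -/
def moyalTerm (ħ : ℝ) (a b : ℝ → ℝ → ℂ) (n : ℕ) (ξ p : ℝ) : ℂ :=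
  (Complex.I * (ħ : ℂ)) ^ n / ((2 : ℂ) ^ n * (n.factorial : ℂ)) *
    ∑ k ∈ Finset.range (n + 1), (n.choose k : ℂ) * (-1) ^ k *
      (partialXi^[k] (partialP^[n - k] a)) ξ p * (partialP^[k] (partialXi^[n - k] b)) ξ p

/-- Integral kernel of the Weyl quantisation of a symbol `a(ξ, p)`:
`(1/(2πħ)) ∫ exp((i/ħ)(p - p') ξ) a(ξ, (p + p')/2) dξ`. -/
def weylKernel (ħ : ℝ) (a : ℝ → ℝ → ℂ) (p p' : ℝ) : ℂ :=
  1 / (2 * (Real.pi : ℂ) * (ħ : ℂ)) *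
    ∫ ξ : ℝ, Complex.exp (Complex.I / (ħ : ℂ) * (((p - p') * ξ : ℝ) : ℂ)) * a ξ ((p + p') / 2)

/-- `w` is a solution, for `t > 0`, of the transformed Lindblad equation
`iħ ∂ₜw = -i [-(ħ²σ²/2) ∂ₚ²w + (γ²η²/2) p² w] - η p w` with initial value `w₀ ∈ L^r(ℝ)`:
it is a classical solution of class `C^{1,2}` on `(0, ∞) × ℝ`, it is bounded in `L^r` on bounded
time intervals, and `w(t, ·) → w₀` in `L^r` as `t → 0+`. -/
structure IsSolution (ħ σ γ η : ℝ) (r : ENNReal) (w₀ : ℝ → ℂ) (w : ℝ → ℝ → ℂ) : Prop where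
  differentiableAt_time : ∀ t > 0, ∀ p, DifferentiableAt ℝ (fun s => w s p) t
  contDiff_space : ∀ t > 0, ContDiff ℝ 2 (w t)
  continuousOn : ContinuousOn (fun x : ℝ × ℝ => w x.1 x.2) (Set.Ioi 0 ×ˢ Set.univ)
  continuousOn_deriv_time :
    ContinuousOn (fun x : ℝ × ℝ => deriv (fun s => w s x.2) x.1) (Set.Ioi 0 ×ˢ Set.univ)
  continuousOn_deriv_space :
    ContinuousOn (fun x : ℝ × ℝ => deriv (w x.1) x.2) (Set.Ioi 0 ×ˢ Set.univ)
  continuousOn_deriv_space_two :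
    ContinuousOn (fun x : ℝ × ℝ => iteratedDeriv 2 (w x.1) x.2) (Set.Ioi 0 ×ˢ Set.univ)
  equation : ∀ t > 0, ∀ p,
    Complex.I * (ħ : ℂ) * deriv (fun s => w s p) t =
      -Complex.I * (-((ħ ^ 2 * σ ^ 2 / 2 : ℝ) : ℂ) * iteratedDeriv 2 (w t) p
          + ((γ ^ 2 * η ^ 2 / 2 * p ^ 2 : ℝ) : ℂ) * w t p)
        - ((η * p : ℝ) : ℂ) * w t p
  memLp : ∀ t > 0, MemLp (w t) r volume
  bounded : ∀ T : ℝ, ∃ C : ℝ≥0, ∀ t ∈ Set.Ioc 0 T, eLpNorm (w t) r volume ≤ C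
  initial : Tendsto (fun t => eLpNorm (fun p => w t p - w₀ p) r volume) (𝓝[>] 0) (𝓝 0)

/-- `K(t, p, p')` is the propagator of the transformed Lindblad equation: for every exponent
`1 ≤ r < ∞` and every initial value `w₀ ∈ L^r(ℝ)`, the absolutely convergent integral
`∫ K(t, p, p') w₀(p') dp'` is a solution with initial value `w₀`, and every solution with
initial value `w₀` is given by it. -/
def IsPropagator (ħ σ γ η : ℝ) (K : ℝ → ℝ → ℝ → ℂ) : Prop :=
  ∀ r : ENNReal, 1 ≤ r → r ≠ ⊤ → ∀ w₀ : ℝ → ℂ, MemLp w₀ r volume →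
    (∀ t > 0, ∀ p, Integrable (fun p' => K t p p' * w₀ p') volume) ∧
    IsSolution ħ σ γ η r w₀ (fun t p => ∫ p', K t p p' * w₀ p') ∧
    ∀ w : ℝ → ℝ → ℂ, IsSolution ħ σ γ η r w₀ w →
      ∀ t > 0, ∀ p, w t p = ∫ p', K t p p' * w₀ p'

end LindbladMehler

end

/-! Put ω = σγη and let τ(t) = 2 tanh(tω/2)/ω, read as t when ω = 0. Everything rests on the Riccati
equation τ' = 1 - ω²τ²/4 (`hasDerivAt_effectiveTime`). The symbol is a scalar amplitude times
exp(-iτH/ħ), and the logarithmic derivative of the amplitude is a polynomial in τ.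

Since H is quadratic, H # exp(κH) has terms of order at most two. The first-order term is the
Poisson bracket of H with a function of H, hence zero; the second-order term is exp(κH) times an
affine function of H (`hasSum_moyalTerm_hamiltonian`). Comparing the coefficients of H and of 1
turns the evolution equation into the Riccati equation and the equation of the amplitude.

For t > 0 the symbol is Gaussian in ξ, so the Weyl kernel is an explicit Gaussian, `mehlerKernel`,
with b proportional to 1/τ and c, d proportional to τ (`weylKernel_propagatorSymbol`,
`mehlerCoefficients`). Gaussian domination allows differentiation under the integral
(`MehlerCoefficients.exists_gaussian_bound`). For the L^r bound and the initial value, the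
substitution q = p - y/√(2b) presents the evolution as a standard normal average of translates of
the data, with weights bounded by 1 and tending to 1 (`integral_mehlerKernel_mul`,
`tendsto_eLpNorm_average_sub`).

Uniqueness is by duality. The kernel is symmetric, so for fixed T and P the function K(T - s, P, q)
solves the backward equation in (s, q), and the pairing s ↦ ∫ K(T - s, P, q) w(s, q) dq is constant
on (0, T): with a cutoff at scale R, Green's formula moves every space derivative off w and leaves
an error O(1/R) (`integral_backward_kernel_const`). The limits of the pairing at s → 0 and s → T are
the evolution of w₀ and w(T, P). -/

noncomputable section

namespace LindbladMehler

/-! ### Effective time and amplitude: regularity and differential equations. -/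

theorem hasDerivAt_tanh (x : ℝ) : HasDerivAt Real.tanh (1 - Real.tanh x ^ 2) x := by
  have h := (Real.hasDerivAt_sinh x).div (Real.hasDerivAt_cosh x) (Real.cosh_pos x).ne'
  have e : Real.tanh = Real.sinh / Real.cosh := by
    ext y; simp [Real.tanh_eq_sinh_div_cosh]
  have e' : Real.tanh x = Real.sinh x / Real.cosh x := Real.tanh_eq_sinh_div_cosh x
  have := (Real.cosh_pos x).ne'
  rw [e', e]
  refine h.congr_deriv ?_
  field_simp

/-- The effective time `2 tanh(tΩ/2)/Ω`, extended by `t` to `Ω = 0`. -/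
def effectiveTime (Ω t : ℝ) : ℝ := if Ω = 0 then t else 2 * Real.tanh (t * Ω / 2) / Ω

theorem effectiveTime_zero_left (t : ℝ) : effectiveTime 0 t = t := by simp [effectiveTime]

theorem effectiveTime_zero_right (Ω : ℝ) : effectiveTime Ω 0 = 0 := by simp [effectiveTime]

/-- The divided difference of tanh at 0 is continuous, with value 1 at 0. This form removes the case
distinction and gives joint continuity across Ω = 0. -/
theorem effectiveTime_eq_mul_dslope (Ω t : ℝ) :
    effectiveTime Ω t = t * dslope Real.tanh 0 (t * Ω / 2) := by
  unfold effectiveTime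
  split_ifs with h
  · simp [h, (hasDerivAt_tanh 0).deriv]
  · by_cases ht : t = 0
    · simp [ht]
    · rw [dslope_of_ne _ (by positivity), slope_def_field]
      simp only [Real.tanh_zero, sub_zero]
      field_simp

theorem differentiable_tanh : Differentiable ℝ Real.tanh := fun x =>
  (hasDerivAt_tanh x).differentiableAt

theorem continuous_effectiveTime : Continuous (fun x : ℝ × ℝ => effectiveTime x.1 x.2) := by
  have h : Continuous (dslope Real.tanh 0) := by
    rw [← continuousOn_univ, continuousOn_dslope univ_mem]
    exact ⟨differentiable_tanh.continuous.continuousOn, differentiable_tanh 0⟩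
  simp only [effectiveTime_eq_mul_dslope]
  fun_prop

theorem omega_mul_effectiveTime (Ω t : ℝ) :
    Ω * effectiveTime Ω t = 2 * Real.tanh (t * Ω / 2) := by
  unfold effectiveTime
  split_ifs with h
  · simp [h]
  · field_simp

/-- The Riccati equation, from tanh' = 1 - tanh². Every later differential equation is a consequence
of it. -/
theorem hasDerivAt_effectiveTime (Ω t : ℝ) :
    HasDerivAt (effectiveTime Ω) (1 - Ω ^ 2 * effectiveTime Ω t ^ 2 / 4) t := by
  by_cases h : Ω = 0
  · have : effectiveTime Ω = id := by ext t; simp [h, effectiveTime]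
    rw [this, h]
    simpa using hasDerivAt_id t
  · have e : effectiveTime Ω = fun t => 2 * Real.tanh (t * Ω / 2) / Ω := by
      ext t; simp [h, effectiveTime]
    have h1 : HasDerivAt (fun t : ℝ => t * Ω / 2) (Ω / 2) t := by
      simpa using ((hasDerivAt_id t).mul_const Ω).div_const 2
    have h2 := (((hasDerivAt_tanh _).comp t h1).const_mul 2).div_const Ω
    have h3 : Ω ^ 2 * effectiveTime Ω t ^ 2 = (2 * Real.tanh (t * Ω / 2)) ^ 2 := by
      rw [← omega_mul_effectiveTime]; ring
    rw [h3, e]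
    refine h2.congr_deriv ?_
    field_simp
    ring

theorem contDiff_effectiveTime (Ω : ℝ) : ContDiff ℝ ∞ (effectiveTime Ω) := by
  by_cases h : Ω = 0
  · have : effectiveTime Ω = id := by ext t; simp [h, effectiveTime]
    rw [this]; exact contDiff_id
  · have e : effectiveTime Ω =
        fun t => 2 * (Real.sinh (t * Ω / 2) / Real.cosh (t * Ω / 2)) / Ω := by
      ext t; simp [h, effectiveTime, Real.tanh_eq_sinh_div_cosh]
    rw [e]
    have hs : ContDiff ℝ ∞ (fun t : ℝ => Real.sinh (t * Ω / 2)) :=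
      Real.contDiff_sinh.comp (by fun_prop)
    have hc : ContDiff ℝ ∞ (fun t : ℝ => Real.cosh (t * Ω / 2)) :=
      Real.contDiff_cosh.comp (by fun_prop)
    exact ((hs.div hc fun t => (Real.cosh_pos _).ne').const_smul (2 : ℝ)).div_const Ω

/-- The scalar prefactor `cosh(tΩ/2)⁻¹ exp(-(t - τ)/(2γ²ħ))` of the symbol. -/
def amplitude (ħ γ Ω t : ℝ) : ℝ :=
  (Real.cosh (t * Ω / 2))⁻¹ * Real.exp (-(1 / (2 * γ ^ 2 * ħ)) * (t - effectiveTime Ω t))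

/-- One formula for all η: at η = 0 the effective time is t, the amplitude is 1 and only the ξ² part
of H survives. As σγ ≠ 0, the cases η = 0 and Ω = 0 coincide. -/
theorem propagatorSymbol_eq {σ γ : ℝ} (hσ : σ ≠ 0) (hγ : γ ≠ 0) (ħ η t ξ p : ℝ) :
    propagatorSymbol ħ σ γ η t ξ p = (amplitude ħ γ (σ * γ * η) t : ℂ) *
      Complex.exp (-(Complex.I / (ħ : ℂ)) * (effectiveTime (σ * γ * η) t : ℂ) *
        hamiltonian σ γ η ξ p) := by
  unfold propagatorSymbol
  split_ifs with h
  · have hI := Complex.I_sq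
    simp only [h, mul_zero, amplitude, effectiveTime_zero_left, hamiltonian]
    simp only [zero_div, Real.cosh_zero, inv_one, sub_self, mul_zero, Real.exp_zero, mul_one,
      Complex.ofReal_one, one_mul]
    congr 1
    push_cast
    linear_combination (-(t : ℂ) * σ ^ 2 * ξ ^ 2 / (2 * ħ)) * hI
  · have : effectiveTime (σ * γ * η) t = 2 * Real.tanh (t * (σ * γ * η) / 2) / (σ * γ * η) := by
        simp only [effectiveTime, mul_ne_zero (mul_ne_zero hσ hγ) h, ↓reduceIte]
    simp only [symbolFormula, amplitude, this]
    push_cast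
    ring

theorem continuous_amplitude (ħ γ : ℝ) :
    Continuous (fun x : ℝ × ℝ => amplitude ħ γ x.1 x.2) := by
  unfold amplitude
  have := continuous_effectiveTime
  refine Continuous.mul (Continuous.inv₀ (by fun_prop) fun x => (Real.cosh_pos _).ne') ?_
  fun_prop

theorem contDiff_amplitude (ħ γ Ω : ℝ) : ContDiff ℝ ∞ (amplitude ħ γ Ω) := by
  unfold amplitude
  have h := contDiff_effectiveTime Ω
  have hc : ContDiff ℝ ∞ (fun t : ℝ => Real.cosh (t * Ω / 2)) :=
    Real.contDiff_cosh.comp (by fun_prop)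
  refine ContDiff.mul (hc.inv fun t => (Real.cosh_pos _).ne') ?_
  fun_prop

/-- The cosh factor contributes -(Ω/2) tanh(tΩ/2) = -Ω²τ/4 and the exponential contributes -(1 -
τ')/(2γ²ħ) = -Ω²τ²/(8γ²ħ). -/
theorem hasDerivAt_amplitude (ħ γ Ω t : ℝ) :
    HasDerivAt (amplitude ħ γ Ω)
      (-(Ω ^ 2 * effectiveTime Ω t / 4 + Ω ^ 2 * effectiveTime Ω t ^ 2 / (8 * γ ^ 2 * ħ)) *
        amplitude ħ γ Ω t) t := by
  have h1 : HasDerivAt (fun t : ℝ => t * Ω / 2) (Ω / 2) t := by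
    simpa using ((hasDerivAt_id t).mul_const Ω).div_const 2
  have hc := ((Real.hasDerivAt_cosh _).comp t h1).inv (Real.cosh_pos _).ne'
  have he := (((hasDerivAt_id t).sub (hasDerivAt_effectiveTime Ω t)).const_mul
    (-(1 / (2 * γ ^ 2 * ħ)))).exp
  have h := hc.mul he
  refine h.congr_deriv ?_
  have h3 : Ω * effectiveTime Ω t = 2 * (Real.sinh (t * Ω / 2) / Real.cosh (t * Ω / 2)) := by
    rw [← Real.tanh_eq_sinh_div_cosh, omega_mul_effectiveTime]
  have h4 : Real.sinh (t * Ω / 2) = Ω * effectiveTime Ω t / 2 * Real.cosh (t * Ω / 2) := by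
    rw [h3]; field_simp [(Real.cosh_pos (t * Ω / 2)).ne']
  have h5 := (Real.cosh_pos (t * Ω / 2)).ne'
  simp only [Function.comp_apply, amplitude, Pi.inv_apply, h4, id, Pi.sub_apply]
  field_simp
  ring

theorem continuous_propagatorSymbol {σ γ : ℝ} (hσ : σ ≠ 0) (hγ : γ ≠ 0) (ħ : ℝ) :
    Continuous (fun x : ℝ × ℝ × ℝ × ℝ => propagatorSymbol ħ σ γ x.1 x.2.1 x.2.2.1 x.2.2.2) := by
  simp only [propagatorSymbol_eq hσ hγ, hamiltonian]
  have h1 : Continuous (fun x : ℝ × ℝ × ℝ × ℝ => amplitude ħ γ (σ * γ * x.1) x.2.1) :=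
    (continuous_amplitude ħ γ).comp (by fun_prop : Continuous (fun x : ℝ × ℝ × ℝ × ℝ =>
      (σ * γ * x.1, x.2.1)))
  have h2 : Continuous (fun x : ℝ × ℝ × ℝ × ℝ => effectiveTime (σ * γ * x.1) x.2.1) :=
    continuous_effectiveTime.comp (by fun_prop : Continuous (fun x : ℝ × ℝ × ℝ × ℝ =>
      (σ * γ * x.1, x.2.1)))
  fun_prop

theorem contDiff_propagatorSymbol {σ γ : ℝ} (hσ : σ ≠ 0) (hγ : γ ≠ 0) (ħ η : ℝ) :
    ContDiff ℝ ∞ (fun x : ℝ × ℝ × ℝ => propagatorSymbol ħ σ γ η x.1 x.2.1 x.2.2) := by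
  simp only [propagatorSymbol_eq hσ hγ, hamiltonian]
  have h0 : ContDiff ℝ ∞ (fun x : ℝ => (x : ℂ)) := Complex.ofRealCLM.contDiff
  have h1 : ContDiff ℝ ∞ (fun x : ℝ × ℝ × ℝ => (amplitude ħ γ (σ * γ * η) x.1 : ℂ)) :=
    h0.comp ((contDiff_amplitude ħ γ _).comp contDiff_fst)
  have h2 : ContDiff ℝ ∞ (fun x : ℝ × ℝ × ℝ => (effectiveTime (σ * γ * η) x.1 : ℂ)) :=
    h0.comp ((contDiff_effectiveTime _).comp contDiff_fst)
  have h3 : ContDiff ℝ ∞ (fun x : ℝ × ℝ × ℝ =>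
      ((σ ^ 2 * x.2.1 ^ 2 + γ ^ 2 * η ^ 2 * x.2.2 ^ 2 : ℝ) : ℂ)) := h0.comp (by fun_prop)
  have h4 : ContDiff ℝ ∞ (fun x : ℝ × ℝ × ℝ => ((η * x.2.2 : ℝ) : ℂ)) := h0.comp (by fun_prop)
  fun_prop

theorem propagatorSymbol_zero {σ γ : ℝ} (hσ : σ ≠ 0) (hγ : γ ≠ 0) (ħ η ξ p : ℝ) : propagatorSymbol ħ σ γ η 0 ξ p = 1 := by
  simp [propagatorSymbol_eq hσ hγ, effectiveTime_zero_right, amplitude]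

/-! ### The Weyl product of the Hamiltonian with exponentials of itself. -/

theorem partialP_zero : partialP 0 = 0 := by
  ext ξ p; simp [partialP]

theorem partialXi_zero : partialXi 0 = 0 := by
  ext ξ p; simp [partialXi]

theorem partialP_const (z : ℂ) : partialP (fun _ _ => z) = 0 := by
  ext ξ p; simp [partialP]

theorem partialXi_const (z : ℂ) : partialXi (fun _ _ => z) = 0 := by
  ext ξ p; simp [partialXi]

theorem iterate_partialP_zero (n : ℕ) : partialP^[n] 0 = 0 :=
  Function.iterate_fixed partialP_zero n

theorem iterate_partialXi_zero (n : ℕ) : partialXi^[n] 0 = 0 :=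
  Function.iterate_fixed partialXi_zero n

theorem hasDerivAt_hamiltonian_xi (σ γ η ξ p : ℝ) :
    HasDerivAt (fun x => hamiltonian σ γ η x p) (-Complex.I * σ ^ 2 * ξ) ξ := by
  have h : HasDerivAt (fun x : ℝ => (x : ℂ)) 1 ξ := Complex.ofRealCLM.hasDerivAt
  have := ((((h.pow 2).const_mul ((σ : ℂ) ^ 2)).add_const ((γ : ℂ) ^ 2 * η ^ 2 * p ^ 2)).const_mul
    (-(Complex.I / 2))).sub_const ((η : ℂ) * p)
  simp only [hamiltonian]
  push_cast
  refine this.congr_deriv ?_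
  push_cast
  ring

theorem hasDerivAt_hamiltonian_p (σ γ η ξ p : ℝ) :
    HasDerivAt (fun y => hamiltonian σ γ η ξ y) (-Complex.I * γ ^ 2 * η ^ 2 * p - η) p := by
  have h : HasDerivAt (fun x : ℝ => (x : ℂ)) 1 p := Complex.ofRealCLM.hasDerivAt
  have := ((((h.pow 2).const_mul ((γ : ℂ) ^ 2 * η ^ 2)).const_add ((σ : ℂ) ^ 2 * ξ ^ 2)).const_mul
    (-(Complex.I / 2))).sub (h.const_mul (η : ℂ))
  simp only [hamiltonian]
  push_cast
  refine this.congr_deriv ?_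
  push_cast
  ring

theorem hasDerivAt_affine_ofReal (z u : ℂ) (x : ℝ) :
    HasDerivAt (fun x : ℝ => z * (x : ℂ) - u) z x := by
  have h : HasDerivAt (fun x : ℝ => (x : ℂ)) 1 x := Complex.ofRealCLM.hasDerivAt
  simpa using (h.const_mul z).sub_const u

/-- The trailing `- 0` gives the derivative the affine shape of `hasDerivAt_affine_ofReal`, used for
the second derivative. -/
theorem partialXi_hamiltonian (σ γ η : ℝ) :
    partialXi (hamiltonian σ γ η) = fun (ξ : ℝ) (_ : ℝ) => -Complex.I * (σ : ℂ) ^ 2 * (ξ : ℂ) - 0 := by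
  ext ξ p; simp [partialXi, (hasDerivAt_hamiltonian_xi σ γ η ξ p).deriv]

theorem partialP_hamiltonian (σ γ η : ℝ) :
    partialP (hamiltonian σ γ η) = fun (_ : ℝ) (p : ℝ) =>
      -Complex.I * (γ : ℂ) ^ 2 * (η : ℂ) ^ 2 * (p : ℂ) - (η : ℂ) := by
  ext ξ p; simp [partialP, (hasDerivAt_hamiltonian_p σ γ η ξ p).deriv]

theorem partialXi_partialXi_hamiltonian (σ γ η : ℝ) :
    partialXi (partialXi (hamiltonian σ γ η)) = fun _ _ => -Complex.I * (σ : ℂ) ^ 2 := by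
  rw [partialXi_hamiltonian]
  ext ξ p
  exact (hasDerivAt_affine_ofReal _ _ _).deriv

theorem partialP_partialP_hamiltonian (σ γ η : ℝ) :
    partialP (partialP (hamiltonian σ γ η)) =
      fun _ _ => -Complex.I * (γ : ℂ) ^ 2 * (η : ℂ) ^ 2 := by
  rw [partialP_hamiltonian]
  ext ξ p
  exact (hasDerivAt_affine_ofReal _ _ _).deriv

theorem partialXi_partialP_hamiltonian (σ γ η : ℝ) :
    partialXi (partialP (hamiltonian σ γ η)) = 0 := by
  rw [partialP_hamiltonian]
  ext ξ p; simp [partialXi]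

/-- Each summand of the `n`-th Moyal term puts exactly `n` derivatives on H, so this stops the
series at n = 2. -/
theorem partial_hamiltonian_eq_zero (σ γ η : ℝ) {m k : ℕ} (h : 3 ≤ m + k) :
    partialXi^[k] (partialP^[m] (hamiltonian σ γ η)) = 0 := by
  match m, k with
  | 0, 0 | 0, 1 | 0, 2 | 1, 0 | 1, 1 | 2, 0 => omega
  | m + 3, k =>
    rw [Function.iterate_add_apply]
    simp only [Function.iterate_succ, Function.iterate_zero, Function.comp_apply, id,
      partialP_partialP_hamiltonian, partialP_const, iterate_partialP_zero,
      iterate_partialXi_zero]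
  | 2, k + 1 =>
    simp only [Function.iterate_succ, Function.iterate_zero, Function.comp_apply, id,
      partialP_partialP_hamiltonian, partialXi_const, iterate_partialXi_zero]
  | 1, k + 1 =>
    simp only [Function.iterate_succ, Function.iterate_zero, Function.comp_apply, id,
      partialXi_partialP_hamiltonian, iterate_partialXi_zero]
  | 0, k + 3 =>
    simp only [Function.iterate_succ, Function.iterate_zero, Function.comp_apply, id,
      partialXi_partialXi_hamiltonian, partialXi_const, iterate_partialXi_zero]

/-- Two derivatives of `C exp(κ h)` along a line on which `h` is quadratic. -/
theorem hasDerivAt_const_mul_cexp {h h' : ℝ → ℂ} {h'' : ℂ} (hh : ∀ x, HasDerivAt h (h' x) x)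
    (hh' : ∀ x, HasDerivAt h' h'' x) (C κ : ℂ) (x : ℝ) :
    HasDerivAt (fun x => C * Complex.exp (κ * h x)) (C * Complex.exp (κ * h x) * (κ * h' x)) x ∧
    HasDerivAt (fun x => C * Complex.exp (κ * h x) * (κ * h' x))
      (C * Complex.exp (κ * h x) * (κ * h'' + (κ * h' x) ^ 2)) x := by
  have h1 : ∀ x, HasDerivAt (fun x => C * Complex.exp (κ * h x))
      (C * Complex.exp (κ * h x) * (κ * h' x)) x := fun x =>
    ((((hh x).const_mul κ).cexp).const_mul C).congr_deriv (by ring)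
  refine ⟨h1 x, ((h1 x).mul ((hh' x).const_mul κ)).congr_deriv (by ring)⟩

/-- The mixed derivative of H vanishes and H_pp H_ξξ = -ω², while H_pp H_ξ² + H_ξξ H_p² = -ω² (2H +
i/γ²). The shift i/γ² comes from completing the square in p: for η ≠ 0 the critical value of H is
-i/(2γ²). -/
theorem hasSum_moyalTerm_hamiltonian {γ : ℝ} (hγ : γ ≠ 0) (ħ σ η : ℝ) (C κ : ℂ) (ξ p : ℝ) :
    HasSum (fun n => moyalTerm ħ (hamiltonian σ γ η)
        (fun ξ p => C * Complex.exp (κ * hamiltonian σ γ η ξ p)) n ξ p)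
      (C * Complex.exp (κ * hamiltonian σ γ η ξ p) *
        (hamiltonian σ γ η ξ p - ħ ^ 2 / 8 * (2 * κ * -(σ * γ * η) ^ 2
          - κ ^ 2 * (σ * γ * η) ^ 2 * (2 * hamiltonian σ γ η ξ p + Complex.I / γ ^ 2)))) := by
  have hγ' : (γ : ℂ) ≠ 0 := by exact_mod_cast hγ
  set A : ℝ → ℝ → ℂ := fun ξ p => C * Complex.exp (κ * hamiltonian σ γ η ξ p) with hA
  have hx (p : ℝ) := hasDerivAt_const_mul_cexp (fun x => hasDerivAt_hamiltonian_xi σ γ η x p)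
    (fun x => (hasDerivAt_affine_ofReal (-Complex.I * (σ : ℂ) ^ 2) 0 x).congr_of_eventuallyEq
      (Eventually.of_forall fun y => (sub_zero _).symm)) C κ
  have hp (ξ : ℝ) := hasDerivAt_const_mul_cexp (fun x => hasDerivAt_hamiltonian_p σ γ η ξ x)
    (fun x => hasDerivAt_affine_ofReal (-Complex.I * (γ : ℂ) ^ 2 * (η : ℂ) ^ 2) η x) C κ
  have hx1 : partialXi A = fun ξ p => A ξ p * (κ * (-Complex.I * σ ^ 2 * ξ)) := by
    ext ξ p; exact (hx p ξ).1.deriv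
  have hp1 : partialP A = fun ξ p => A ξ p * (κ * (-Complex.I * γ ^ 2 * η ^ 2 * p - η)) := by
    ext ξ p; exact (hp ξ p).1.deriv
  have hx2 : partialXi (partialXi A) = fun ξ p => A ξ p *
      (κ * (-Complex.I * σ ^ 2) + (κ * (-Complex.I * σ ^ 2 * ξ)) ^ 2) := by
    rw [hx1]; ext ξ p; exact (hx p ξ).2.deriv
  have hp2 : partialP (partialP A) = fun ξ p => A ξ p *
      (κ * (-Complex.I * γ ^ 2 * η ^ 2) + (κ * (-Complex.I * γ ^ 2 * η ^ 2 * p - η)) ^ 2) := by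
    rw [hp1]; ext ξ p; exact (hp ξ p).2.deriv
  have h := hasSum_sum_of_ne_finset_zero (L := SummationFilter.unconditional ℕ)
    (s := Finset.range 3)
    (f := fun n => moyalTerm ħ (hamiltonian σ γ η) A n ξ p) (fun n hn => by
      rw [Finset.mem_range, not_lt] at hn
      refine mul_eq_zero_of_right _ (Finset.sum_eq_zero fun k hk => ?_)
      rw [Finset.mem_range] at hk
      rw [partial_hamiltonian_eq_zero σ γ η (by omega)]
      simp)
  convert h using 1
  simp only [moyalTerm, Finset.sum_range_succ, Finset.sum_range_zero, Function.iterate_succ,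
    Function.iterate_zero, Function.comp_apply, id, Nat.sub_zero, Nat.sub_self,
    Nat.reduceSub, zero_add, partialXi_partialXi_hamiltonian,
    partialP_partialP_hamiltonian, partialXi_partialP_hamiltonian, hx2, hp2]
  simp only [hx1, hp1, partialXi_hamiltonian, partialP_hamiltonian, hamiltonian, Pi.zero_apply]
  change A ξ p * _ = _
  generalize A ξ p = E
  norm_num [Nat.factorial]
  field_simp
  ring_nf
  simp only [show Complex.I ^ 3 = -Complex.I by rw [pow_succ, Complex.I_sq]; ring,
    show Complex.I ^ 4 = 1 by rw [pow_mul Complex.I 2 2, Complex.I_sq]; ring,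
    show Complex.I ^ 5 = Complex.I by rw [pow_succ, pow_mul Complex.I 2 2, Complex.I_sq]; ring]
  ring

/-- Take κ = -iτ/ħ in `hasSum_moyalTerm_hamiltonian`. The coefficient of H is then 1 - ω²τ²/4 = τ',
and the constant term is iħ times the logarithmic derivative of the amplitude. -/
theorem hasSum_moyalTerm_propagatorSymbol {ħ σ γ : ℝ} (hħ : 0 < ħ) (hσ : σ ≠ 0) (hγ : γ ≠ 0)
    (η t ξ p : ℝ) :
    HasSum (fun n => moyalTerm ħ (hamiltonian σ γ η) (propagatorSymbol ħ σ γ η t) n ξ p)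
      (Complex.I * (ħ : ℂ) * deriv (fun s => propagatorSymbol ħ σ γ η s ξ p) t) := by
  have e : propagatorSymbol ħ σ γ η t = fun ξ p => (amplitude ħ γ (σ * γ * η) t : ℂ) *
      Complex.exp (-(Complex.I / (ħ : ℂ)) * (effectiveTime (σ * γ * η) t : ℂ) *
        hamiltonian σ γ η ξ p) := by
    ext ξ p; exact propagatorSymbol_eq hσ hγ _ _ _ _ _
  have hd := (hasDerivAt_amplitude ħ γ (σ * γ * η) t).ofReal_comp.mul
    ((((hasDerivAt_effectiveTime (σ * γ * η) t).ofReal_comp.const_mul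
      (-(Complex.I / (ħ : ℂ)))).mul_const (hamiltonian σ γ η ξ p)).cexp)
  have e' : (fun s => propagatorSymbol ħ σ γ η s ξ p) = _ :=
    funext fun s => propagatorSymbol_eq hσ hγ ħ η s ξ p
  rw [e', e, HasDerivAt.deriv (f := fun s => (amplitude ħ γ (σ * γ * η) s : ℂ) * _) hd]
  convert hasSum_moyalTerm_hamiltonian hγ ħ σ η _ _ ξ p using 1
  have h1 : (ħ : ℂ) ≠ 0 := by exact_mod_cast hħ.ne'
  have h2 : (γ : ℂ) ≠ 0 := by exact_mod_cast hγ
  push_cast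
  generalize Complex.exp _ = E
  field_simp
  ring_nf
  simp only [Complex.I_sq, show Complex.I ^ 3 = -Complex.I by rw [pow_succ, Complex.I_sq]; ring]
  ring

/-! ### The Gaussian kernel: its evolution equation and its bounds. -/

section

/-- Half of the Gaussian decay absorbs a quadratic polynomial, by 1 + x ≤ exp x at x = βq²/4. -/
theorem one_add_sq_mul_exp_le {β : ℝ} (hβ : 0 < β) (q : ℝ) :
    (1 + q ^ 2) * Real.exp (-(β / 2) * q ^ 2) ≤ max 1 (4 / β) * Real.exp (-(β / 4) * q ^ 2) := by
  have h1 : 1 + q ^ 2 ≤ max 1 (4 / β) * Real.exp (β / 4 * q ^ 2) := by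
    have h2 := Real.add_one_le_exp (β / 4 * q ^ 2)
    have hm0 : 0 ≤ max 1 (4 / β) := by positivity
    calc 1 + q ^ 2 = 1 + 4 / β * (β / 4 * q ^ 2) := by field_simp
      _ ≤ max 1 (4 / β) + max 1 (4 / β) * (β / 4 * q ^ 2) := by
        gcongr
        · exact le_max_left _ _
        · exact le_max_right _ _
      _ = max 1 (4 / β) * (β / 4 * q ^ 2 + 1) := by ring
      _ ≤ _ := by gcongr
  calc (1 + q ^ 2) * Real.exp (-(β / 2) * q ^ 2) ≤
      max 1 (4 / β) * Real.exp (β / 4 * q ^ 2) * Real.exp (-(β / 2) * q ^ 2) := by gcongr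
    _ = _ := by rw [mul_assoc, ← Real.exp_add]; ring_nf

/-- Coefficient functions of a Gaussian kernel
`α √(b/π) exp(-b (p - q)² - c (p + q)² + i d (p + q))` solving
`∂ₜw = D ∂ₚ²w - v p² w + i e p w` for `t > 0` with a Dirac mass as initial value. -/
structure MehlerCoefficients (D v e : ℝ) (α b c d : ℝ → ℝ) : Prop where
  b_pos : ∀ t > 0, 0 < b t
  c_nonneg : ∀ t > 0, 0 ≤ c t
  α_nonneg : ∀ t > 0, 0 ≤ α t
  α_le_one : ∀ t > 0, α t ≤ 1
  hasDerivAt_b : ∀ t > 0, HasDerivAt b (v / 4 - 4 * D * b t ^ 2) t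
  hasDerivAt_c : ∀ t > 0, HasDerivAt c (v / 4 - 4 * D * c t ^ 2) t
  hasDerivAt_d : ∀ t > 0, HasDerivAt d (e / 2 - 4 * D * c t * d t) t
  hasDerivAt_α : ∀ t > 0, HasDerivAt α (-(D * d t ^ 2 + 4 * D * c t) * α t) t
  b_mul_c : ∀ t > 0, 16 * D * b t * c t = v
  b_mul_d : ∀ t > 0, 8 * D * b t * d t = e
  tendsto_b : Tendsto b (𝓝[>] 0) atTop
  tendsto_c : Tendsto c (𝓝[>] 0) (𝓝 0)
  tendsto_d : Tendsto d (𝓝[>] 0) (𝓝 0)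
  tendsto_α : Tendsto α (𝓝[>] 0) (𝓝 1)

/-- The Gaussian kernel `α √(b/π) exp(-b (p - q)² - c (p + q)² + i d (p + q))`. -/
def mehlerKernel (α b c d : ℝ → ℝ) (t p q : ℝ) : ℂ :=
  ((α t * √(b t / Real.pi) : ℝ) : ℂ) *
    Complex.exp (((-(b t * (p - q) ^ 2) - c t * (p + q) ^ 2 : ℝ) : ℂ) +
      Complex.I * ((d t * (p + q) : ℝ) : ℂ))

/-- The logarithmic derivative of `mehlerKernel` in `p`. -/
def mehlerSlope (b c d : ℝ → ℝ) (t p q : ℝ) : ℂ :=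
  ((-2 * b t * (p - q) - 2 * c t * (p + q) : ℝ) : ℂ) + Complex.I * (d t : ℂ)

/-- The first derivative of `mehlerKernel` in `p`. -/
def mehlerKernelD (α b c d : ℝ → ℝ) (t p q : ℝ) : ℂ :=
  mehlerSlope b c d t p q * mehlerKernel α b c d t p q

/-- The second derivative of `mehlerKernel` in `p`. -/
def mehlerKernelDD (α b c d : ℝ → ℝ) (t p q : ℝ) : ℂ :=
  (mehlerSlope b c d t p q ^ 2 - ((2 * b t + 2 * c t : ℝ) : ℂ)) * mehlerKernel α b c d t p q

/-- The derivative of `mehlerKernel` in `t`. -/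
def mehlerKernelT (D v e : ℝ) (α b c d : ℝ → ℝ) (t p q : ℝ) : ℂ :=
  D * mehlerKernelDD α b c d t p q +
    (-(v * p ^ 2 : ℝ) + Complex.I * (e * p : ℝ)) * mehlerKernel α b c d t p q

variable {D v e : ℝ} {α b c d : ℝ → ℝ}

theorem mehlerKernel_symm (t p q : ℝ) :
    mehlerKernel α b c d t p q = mehlerKernel α b c d t q p := by
  unfold mehlerKernel
  rw [add_comm p q, ← neg_sub p q, neg_sq]

/-- Both orders of the arguments occur: existence differentiates in the free variable, uniqueness in
the variable of integration. -/
theorem norm_mehlerSlope_le {B M : ℝ} {t p q : ℝ} (hb : |b t| ≤ B) (hc : |c t| ≤ B)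
    (hd : |d t| ≤ B) (hp : |p| ≤ M) :
    ‖mehlerSlope b c d t p q‖ ≤ (4 * B * M + 5 * B) * (1 + |q|) ∧
    ‖mehlerSlope b c d t q p‖ ≤ (4 * B * M + 5 * B) * (1 + |q|) := by
  have hB : 0 ≤ B := (abs_nonneg _).trans hb
  have hM : 0 ≤ M := (abs_nonneg _).trans hp
  have key : ∀ x y : ℝ, |x| ≤ M + |q| → |y| ≤ M + |q| →
      ‖((-2 * b t * x - 2 * c t * y : ℝ) : ℂ) + Complex.I * (d t : ℂ)‖ ≤
        (4 * B * M + 5 * B) * (1 + |q|) := by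
    intro x y hx hy
    have h1 : |b t * x| ≤ B * (M + |q|) := by
      rw [abs_mul]; exact mul_le_mul hb hx (abs_nonneg _) hB
    have h2 : |c t * y| ≤ B * (M + |q|) := by
      rw [abs_mul]; exact mul_le_mul hc hy (abs_nonneg _) hB
    have h3 : |-2 * b t * x - 2 * c t * y| ≤ 4 * (B * (M + |q|)) := by
      rw [abs_le] at h1 h2 ⊢
      constructor <;> linarith
    refine (norm_add_le _ _).trans ?_
    rw [norm_mul, Complex.norm_I, one_mul, Complex.norm_real, Complex.norm_real,
      Real.norm_eq_abs, Real.norm_eq_abs]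
    nlinarith [mul_nonneg hB (abs_nonneg q), mul_nonneg (mul_nonneg hB hM) (abs_nonneg q)]
  have h1 : |p - q| ≤ M + |q| := (abs_sub _ _).trans (by linarith)
  have h2 : |p + q| ≤ M + |q| := (abs_add_le _ _).trans (by linarith)
  exact ⟨key _ _ h1 h2, key _ _ (by rwa [abs_sub_comm]) (by rwa [add_comm])⟩

theorem norm_mehlerKernel (t p q : ℝ) : ‖mehlerKernel α b c d t p q‖ =
    |α t| * √(b t / Real.pi) * Real.exp (-(b t * (p - q) ^ 2) - c t * (p + q) ^ 2) := by
  unfold mehlerKernel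
  rw [norm_mul, Complex.norm_exp, Complex.norm_real, Real.norm_eq_abs, abs_mul,
    abs_of_nonneg (Real.sqrt_nonneg _), Complex.add_re, Complex.ofReal_re, Complex.I_mul_re,
    Complex.ofReal_im, neg_zero, add_zero]

theorem norm_mehlerKernel_le {β B M t p : ℝ} (hα : 0 ≤ α t) (hα' : α t ≤ 1) (hβ : 0 ≤ β)
    (hb : β ≤ b t) (hbB : b t ≤ B) (hc : 0 ≤ c t) (hp : |p| ≤ M) (q : ℝ) :
    ‖mehlerKernel α b c d t p q‖ ≤
      √(B / Real.pi) * Real.exp (β * M ^ 2) * Real.exp (-(β / 2) * q ^ 2) := by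
  rw [norm_mehlerKernel, abs_of_nonneg hα, mul_assoc, mul_assoc, ← Real.exp_add]
  refine (mul_le_of_le_one_left (by positivity) hα').trans ?_
  gcongr
  have h1 := mul_nonneg hc (sq_nonneg (p + q))
  have h2 : β * (p - q) ^ 2 ≤ b t * (p - q) ^ 2 := mul_le_mul_of_nonneg_right hb (sq_nonneg _)
  have h3 : p ^ 2 ≤ M ^ 2 := by rw [← sq_abs p]; gcongr
  -- From 2(p - q)² - q² + 2p² = (2p - q)².
  have h4 : q ^ 2 / 2 - M ^ 2 ≤ (p - q) ^ 2 := by nlinarith [sq_nonneg (2 * p - q)]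
  nlinarith [mul_le_mul_of_nonneg_left h4 hβ]

/-- The polynomial factors of the derivatives of the kernel grow at most quadratically in `q`. -/
theorem exists_mehler_factor_bound (D v e B M : ℝ) : ∃ P : ℝ, 0 ≤ P ∧
    ∀ {b c d : ℝ → ℝ} {t p : ℝ}, |b t| ≤ B → |c t| ≤ B → |d t| ≤ B → |p| ≤ M → ∀ q : ℝ,
      ‖(1 : ℂ)‖ ≤ P * (1 + q ^ 2) ∧
      ‖mehlerSlope b c d t p q‖ ≤ P * (1 + q ^ 2) ∧
      ‖mehlerSlope b c d t q p‖ ≤ P * (1 + q ^ 2) ∧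
      ‖mehlerSlope b c d t p q ^ 2 - ((2 * b t + 2 * c t : ℝ) : ℂ)‖ ≤ P * (1 + q ^ 2) ∧
      ‖(D : ℂ) * (mehlerSlope b c d t p q ^ 2 - ((2 * b t + 2 * c t : ℝ) : ℂ)) +
        (-(v * p ^ 2 : ℝ) + Complex.I * (e * p : ℝ))‖ ≤ P * (1 + q ^ 2) := by
  by_cases hBM : 0 ≤ B ∧ 0 ≤ M
  swap
  · refine ⟨0, le_rfl, fun hb _ _ hp => (hBM ⟨(abs_nonneg _).trans hb, (abs_nonneg _).trans hp⟩).elim⟩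
  obtain ⟨hB, hM⟩ := hBM
  obtain ⟨S, hS⟩ : ∃ S, S = 4 * B * M + 5 * B := ⟨_, rfl⟩
  have hS0 : 0 ≤ S := by rw [hS]; positivity
  obtain ⟨T, hT⟩ : ∃ T, T = 2 * S ^ 2 + 4 * B := ⟨_, rfl⟩
  have hT0 : 0 ≤ T := by rw [hT]; positivity
  obtain ⟨V, hV⟩ : ∃ V, V = |v| * M ^ 2 + |e| * M := ⟨_, rfl⟩
  have hV0 : 0 ≤ V := by rw [hV]; positivity
  have hDT : 0 ≤ |D| * T := by positivity
  refine ⟨1 + 2 * S + T + |D| * T + V, by positivity, fun {b c d t p} hb hc hd hp q => ?_⟩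
  obtain ⟨hs1, hs2⟩ := norm_mehlerSlope_le (q := q) hb hc hd hp
  rw [← hS] at hs1 hs2
  have hq0 : 0 ≤ 1 + q ^ 2 := by positivity
  have hq : 1 + |q| ≤ 2 * (1 + q ^ 2) := by
    rw [← sq_abs q]; nlinarith [sq_nonneg (|q| - 1), sq_nonneg (|q|)]
  have hq2 : (1 + |q|) ^ 2 ≤ 2 * (1 + q ^ 2) := by
    rw [← sq_abs q]; nlinarith [sq_nonneg (|q| - 1)]
  have hsq : S * (1 + |q|) ≤ 2 * S * (1 + q ^ 2) :=
    (mul_le_mul_of_nonneg_left hq hS0).trans_eq (by ring)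
  have hDD : ‖mehlerSlope b c d t p q ^ 2 - ((2 * b t + 2 * c t : ℝ) : ℂ)‖ ≤ T * (1 + q ^ 2) := by
    refine (norm_sub_le _ _).trans ?_
    rw [norm_pow, Complex.norm_real, Real.norm_eq_abs]
    have h1 : ‖mehlerSlope b c d t p q‖ ^ 2 ≤ S ^ 2 * (2 * (1 + q ^ 2)) := by
      calc _ ≤ (S * (1 + |q|)) ^ 2 := by gcongr
        _ = S ^ 2 * (1 + |q|) ^ 2 := by ring
        _ ≤ _ := by gcongr
    have h2 : |2 * b t + 2 * c t| ≤ 4 * B := by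
      rw [abs_le] at hb hc ⊢; constructor <;> linarith
    rw [hT]
    nlinarith [mul_nonneg hB (sq_nonneg q)]
  have hVb : ‖(-(v * p ^ 2 : ℝ) + Complex.I * (e * p : ℝ) : ℂ)‖ ≤ V := by
    refine (norm_add_le _ _).trans ?_
    rw [norm_neg, norm_mul, Complex.norm_I, one_mul, Complex.norm_real, Complex.norm_real,
      Real.norm_eq_abs, Real.norm_eq_abs, abs_mul, abs_mul, abs_pow, hV]
    gcongr
  refine ⟨?_, hs1.trans (hsq.trans ?_), hs2.trans (hsq.trans ?_), hDD.trans ?_, ?_⟩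
  · rw [norm_one]; nlinarith [sq_nonneg q]
  · gcongr; linarith
  · gcongr; linarith
  · gcongr; linarith
  · refine (norm_add_le _ _).trans ?_
    rw [norm_mul, Complex.norm_real, Real.norm_eq_abs]
    calc _ ≤ |D| * (T * (1 + q ^ 2)) + V := by gcongr
      _ ≤ (|D| * T + V) * (1 + q ^ 2) := by nlinarith [mul_nonneg hV0 (sq_nonneg q)]
      _ ≤ _ := by gcongr; linarith

theorem hasDerivAt_mehlerSlope (t p q : ℝ) :
    HasDerivAt (fun x => mehlerSlope b c d t x q) (-((2 * b t + 2 * c t : ℝ) : ℂ)) p := by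
  have h1 := ((((hasDerivAt_id p).sub_const q).const_mul (-2 * b t)).sub
    (((hasDerivAt_id p).add_const q).const_mul (2 * c t))).ofReal_comp.add_const
      (Complex.I * (d t : ℂ))
  refine h1.congr_deriv ?_
  push_cast
  ring

theorem hasDerivAt_mehlerKernel (t p q : ℝ) :
    HasDerivAt (fun x => mehlerKernel α b c d t x q) (mehlerKernelD α b c d t p q) p := by
  have h1 := (((((hasDerivAt_id p).sub_const q).pow 2).const_mul (b t)).neg.sub
    ((((hasDerivAt_id p).add_const q).pow 2).const_mul (c t))).ofReal_comp
  have h2 := ((((hasDerivAt_id p).add_const q).const_mul (d t)).ofReal_comp).const_mul Complex.I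
  have h3 := (h1.add h2).cexp.const_mul ((α t * √(b t / Real.pi) : ℝ) : ℂ)
  refine h3.congr_deriv ?_
  simp only [mehlerKernelD, mehlerKernel, mehlerSlope, Pi.add_apply, Pi.sub_apply, Pi.neg_apply,
    Pi.pow_apply, id]
  push_cast
  ring

theorem hasDerivAt_mehlerKernelD (t p q : ℝ) :
    HasDerivAt (fun x => mehlerKernelD α b c d t x q) (mehlerKernelDD α b c d t p q) p := by
  refine ((hasDerivAt_mehlerSlope t p q).mul (hasDerivAt_mehlerKernel t p q)).congr_deriv ?_
  simp only [mehlerKernelD, mehlerKernelDD]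
  ring

namespace MehlerCoefficients

theorem hasDerivAt_mehlerKernel_time (h : MehlerCoefficients D v e α b c d) {t : ℝ} (ht : 0 < t) (p q : ℝ) :
    HasDerivAt (fun s => mehlerKernel α b c d s p q) (mehlerKernelT D v e α b c d t p q) t := by
  have hb := h.b_pos t ht
  have hbπ : 0 < b t / Real.pi := div_pos hb Real.pi_pos
  have h1 := (((h.hasDerivAt_b t ht).mul_const ((p - q) ^ 2)).neg.sub
    ((h.hasDerivAt_c t ht).mul_const ((p + q) ^ 2))).ofReal_comp
  have h2 := (((h.hasDerivAt_d t ht).mul_const (p + q)).ofReal_comp).const_mul Complex.I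
  have h0 := ((h.hasDerivAt_α t ht).mul
    (((h.hasDerivAt_b t ht).div_const Real.pi).sqrt hbπ.ne')).ofReal_comp
  have h3 := h0.mul (h1.add h2).cexp
  refine h3.congr_deriv ?_
  have hs : √(b t / Real.pi) ≠ 0 := (Real.sqrt_pos.2 hbπ).ne'
  -- Since v = 16Dbc, b'/(2b) = v/(8b) - 2Db equals 2Dc - 2Db, so the factor √(b/π) also has a
  -- polynomial logarithmic derivative.
  have e0 : (v / 4 - 4 * D * b t ^ 2) / Real.pi / (2 * √(b t / Real.pi)) =
      (2 * D * c t - 2 * D * b t) * √(b t / Real.pi) := by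
    rw [div_eq_iff (by positivity)]
    rw [show (2 * D * c t - 2 * D * b t) * √(b t / Real.pi) * (2 * √(b t / Real.pi)) =
      2 * (2 * D * c t - 2 * D * b t) * (√(b t / Real.pi) * √(b t / Real.pi)) by ring,
      Real.mul_self_sqrt hbπ.le, ← h.b_mul_c t ht]
    field_simp
    ring
  -- With v and e eliminated, both sides are polynomials in the coefficients times the same
  -- exponential.
  have ev : (v : ℂ) = 16 * D * b t * c t := by exact_mod_cast (h.b_mul_c t ht).symm
  have ee : (e : ℂ) = 8 * D * b t * d t := by exact_mod_cast (h.b_mul_d t ht).symm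
  simp only [e0, mehlerKernelT, mehlerKernelDD, mehlerKernel, mehlerSlope, Pi.add_apply,
    Pi.sub_apply, Pi.neg_apply, Pi.mul_apply]
  push_cast
  simp only [ev, ee]
  generalize Complex.exp _ = E
  generalize ((√(b t / Real.pi) : ℝ) : ℂ) = s
  ring_nf
  simp only [Complex.I_sq]
  ring

theorem continuousOn_b (h : MehlerCoefficients D v e α b c d) : ContinuousOn b (Set.Ioi 0) :=
  fun t ht => (h.hasDerivAt_b t ht).continuousAt.continuousWithinAt

theorem continuousOn_c (h : MehlerCoefficients D v e α b c d) : ContinuousOn c (Set.Ioi 0) :=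
  fun t ht => (h.hasDerivAt_c t ht).continuousAt.continuousWithinAt

theorem continuousOn_d (h : MehlerCoefficients D v e α b c d) : ContinuousOn d (Set.Ioi 0) :=
  fun t ht => (h.hasDerivAt_d t ht).continuousAt.continuousWithinAt

theorem continuousOn_α (h : MehlerCoefficients D v e α b c d) : ContinuousOn α (Set.Ioi 0) :=
  fun t ht => (h.hasDerivAt_α t ht).continuousAt.continuousWithinAt

theorem continuousOn_mehlerKernel (h : MehlerCoefficients D v e α b c d) : ContinuousOn
    (fun x : ℝ × ℝ × ℝ => mehlerKernel α b c d x.1 x.2.1 x.2.2) (Set.Ioi 0 ×ˢ Set.univ) := by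
  have hm : Set.MapsTo (fun x : ℝ × ℝ × ℝ => x.1) (Set.Ioi 0 ×ˢ Set.univ) (Set.Ioi 0) :=
    fun x hx => hx.1
  have hb := h.continuousOn_b.comp continuousOn_fst hm
  have hc := h.continuousOn_c.comp continuousOn_fst hm
  have hd := h.continuousOn_d.comp continuousOn_fst hm
  have hα := h.continuousOn_α.comp continuousOn_fst hm
  simp only [Function.comp_def] at hb hc hd hα
  have hF : Continuous (fun y : ℝ × ℝ × ℝ × ℝ × ℝ × ℝ => ((y.1 * √(y.2.1 / Real.pi) : ℝ) : ℂ) *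
      Complex.exp (((-(y.2.1 * (y.2.2.2.2.1 - y.2.2.2.2.2) ^ 2) -
        y.2.2.1 * (y.2.2.2.2.1 + y.2.2.2.2.2) ^ 2 : ℝ) : ℂ) +
        Complex.I * ((y.2.2.2.1 * (y.2.2.2.2.1 + y.2.2.2.2.2) : ℝ) : ℂ))) := by fun_prop
  exact hF.comp_continuousOn (hα.prodMk (hb.prodMk (hc.prodMk (hd.prodMk continuousOn_snd))))

theorem continuousOn_mehlerSlope (h : MehlerCoefficients D v e α b c d) : ContinuousOn
    (fun x : ℝ × ℝ × ℝ => mehlerSlope b c d x.1 x.2.1 x.2.2) (Set.Ioi 0 ×ˢ Set.univ) := by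
  have hm : Set.MapsTo (fun x : ℝ × ℝ × ℝ => x.1) (Set.Ioi 0 ×ˢ Set.univ) (Set.Ioi 0) :=
    fun x hx => hx.1
  have hb := h.continuousOn_b.comp continuousOn_fst hm
  have hc := h.continuousOn_c.comp continuousOn_fst hm
  have hd := h.continuousOn_d.comp continuousOn_fst hm
  simp only [Function.comp_def] at hb hc hd
  have hF : Continuous (fun y : ℝ × ℝ × ℝ × ℝ × ℝ =>
      ((-2 * y.1 * (y.2.2.2.1 - y.2.2.2.2) - 2 * y.2.1 * (y.2.2.2.1 + y.2.2.2.2) : ℝ) : ℂ) +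
        Complex.I * (y.2.2.1 : ℂ)) := by fun_prop
  exact hF.comp_continuousOn (hb.prodMk (hc.prodMk (hd.prodMk continuousOn_snd)))

theorem continuousOn_mehlerKernelD (h : MehlerCoefficients D v e α b c d) : ContinuousOn
    (fun x : ℝ × ℝ × ℝ => mehlerKernelD α b c d x.1 x.2.1 x.2.2) (Set.Ioi 0 ×ˢ Set.univ) :=
  h.continuousOn_mehlerSlope.mul h.continuousOn_mehlerKernel

theorem continuousOn_mehlerKernelDD (h : MehlerCoefficients D v e α b c d) : ContinuousOn
    (fun x : ℝ × ℝ × ℝ => mehlerKernelDD α b c d x.1 x.2.1 x.2.2) (Set.Ioi 0 ×ˢ Set.univ) := by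
  have hm : Set.MapsTo (fun x : ℝ × ℝ × ℝ => x.1) (Set.Ioi 0 ×ˢ Set.univ) (Set.Ioi 0) :=
    fun x hx => hx.1
  have hb := h.continuousOn_b.comp continuousOn_fst hm
  have hc := h.continuousOn_c.comp continuousOn_fst hm
  simp only [Function.comp_def] at hb hc
  have h1 := h.continuousOn_mehlerSlope
  have h2 := h.continuousOn_mehlerKernel
  exact ((h1.pow 2).sub (Complex.continuous_ofReal.comp_continuousOn
    ((continuousOn_const.mul hb).add (continuousOn_const.mul hc)))).mul h2

theorem continuousOn_mehlerKernelT (h : MehlerCoefficients D v e α b c d) : ContinuousOn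
    (fun x : ℝ × ℝ × ℝ => mehlerKernelT D v e α b c d x.1 x.2.1 x.2.2)
    (Set.Ioi 0 ×ˢ Set.univ) := by
  have h1 := h.continuousOn_mehlerKernelDD
  have h2 := h.continuousOn_mehlerKernel
  unfold mehlerKernelT
  fun_prop

/-- On boxes bounded away from `t = 0` the kernel and its derivatives are dominated by a
Gaussian in `q`. -/
theorem exists_gaussian_bound (h : MehlerCoefficients D v e α b c d) {t₁ : ℝ} (t₂ M : ℝ) (ht : 0 < t₁) : ∃ C β : ℝ, 0 ≤ C ∧ 0 < β ∧
    ∀ t ∈ Set.Icc t₁ t₂, ∀ p : ℝ, |p| ≤ M → ∀ q : ℝ,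
      ‖mehlerKernel α b c d t p q‖ ≤ C * Real.exp (-β * q ^ 2) ∧
      ‖mehlerKernelD α b c d t p q‖ ≤ C * Real.exp (-β * q ^ 2) ∧
      ‖mehlerKernelD α b c d t q p‖ ≤ C * Real.exp (-β * q ^ 2) ∧
      ‖mehlerKernelDD α b c d t p q‖ ≤ C * Real.exp (-β * q ^ 2) ∧
      ‖mehlerKernelT D v e α b c d t p q‖ ≤ C * Real.exp (-β * q ^ 2) := by
  have hsub : Set.Icc t₁ t₂ ⊆ Set.Ioi 0 := fun t h' => ht.trans_le h'.1
  obtain ⟨β₀, hβ₀, hβ⟩ : ∃ β₀ > 0, ∀ t ∈ Set.Icc t₁ t₂, β₀ ≤ b t := by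
    rcases (Set.Icc t₁ t₂).eq_empty_or_nonempty with he | hne
    · exact ⟨1, one_pos, by simp [he]⟩
    · obtain ⟨s, hs, hs'⟩ := isCompact_Icc.exists_isMinOn hne (h.continuousOn_b.mono hsub)
      exact ⟨b s, h.b_pos s (hsub hs), fun t h' => hs' h'⟩
  obtain ⟨B₁, hB₁⟩ := isCompact_Icc.exists_bound_of_continuousOn (h.continuousOn_b.mono hsub)
  obtain ⟨B₂, hB₂⟩ := isCompact_Icc.exists_bound_of_continuousOn (h.continuousOn_c.mono hsub)
  obtain ⟨B₃, hB₃⟩ := isCompact_Icc.exists_bound_of_continuousOn (h.continuousOn_d.mono hsub)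
  obtain ⟨B, h1B, h2B, h3B⟩ : ∃ B, B₁ ≤ B ∧ B₂ ≤ B ∧ B₃ ≤ B :=
    ⟨max (max B₁ B₂) B₃, (le_max_left _ _).trans (le_max_left _ _),
      (le_max_right _ _).trans (le_max_left _ _), le_max_right _ _⟩
  obtain ⟨P, hP0, hP⟩ := exists_mehler_factor_bound D v e B |M|
  have hm : 0 ≤ max 1 (4 / β₀) := by positivity
  refine ⟨P * max 1 (4 / β₀) * (√(B / Real.pi) * Real.exp (β₀ * |M| ^ 2)), β₀ / 4, by positivity,
    by positivity, fun t htt p hp q => ?_⟩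
  have ht0 : 0 < t := hsub htt
  have hpM : |p| ≤ |M| := hp.trans (le_abs_self M)
  have hK := norm_mehlerKernel_le (d := d) (h.α_nonneg t ht0) (h.α_le_one t ht0) hβ₀.le (hβ t htt)
    (((le_abs_self _).trans (hB₁ t htt)).trans h1B) (h.c_nonneg t ht0) hpM q
  -- Each derivative is the kernel times a factor growing at most quadratically in q, so a single
  -- estimate serves all five bounds.
  have hfac : ∀ R : ℂ, ‖R‖ ≤ P * (1 + q ^ 2) → ‖R * mehlerKernel α b c d t p q‖ ≤
      P * max 1 (4 / β₀) * (√(B / Real.pi) * Real.exp (β₀ * |M| ^ 2)) *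
        Real.exp (-(β₀ / 4) * q ^ 2) := by
    intro R hR
    generalize √(B / Real.pi) * Real.exp (β₀ * |M| ^ 2) = L at hK ⊢
    have hL : 0 ≤ L := by
      have := (norm_nonneg _).trans hK
      exact nonneg_of_mul_nonneg_left this (Real.exp_pos _)
    rw [norm_mul]
    calc ‖R‖ * ‖mehlerKernel α b c d t p q‖ ≤
        P * (1 + q ^ 2) * (L * Real.exp (-(β₀ / 2) * q ^ 2)) := by gcongr
      _ = P * L * ((1 + q ^ 2) * Real.exp (-(β₀ / 2) * q ^ 2)) := by ring
      _ ≤ P * L * (max 1 (4 / β₀) * Real.exp (-(β₀ / 4) * q ^ 2)) :=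
        mul_le_mul_of_nonneg_left (one_add_sq_mul_exp_le hβ₀ q) (by positivity)
      _ = _ := by ring
  obtain ⟨r1, r2, r3, r4, r5⟩ := hP ((hB₁ t htt).trans h1B) ((hB₂ t htt).trans h2B)
    ((hB₃ t htt).trans h3B) hpM q
  refine ⟨?_, hfac _ r2, ?_, hfac _ r4, ?_⟩
  · have := hfac 1 r1
    rwa [one_mul] at this
  · rw [mehlerKernelD, mehlerKernel_symm t q p]
    exact hfac _ r3
  · rw [mehlerKernelT, mehlerKernelDD, ← mul_assoc, ← add_mul]
    exact hfac _ r5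

end MehlerCoefficients

/-- Functions in `L^r` pair with Gaussians. -/
theorem exists_lintegral_gaussian_le {β : ℝ} (hβ : 0 < β) {r : ENNReal} (hr : 1 ≤ r) :
    ∃ C : ℝ≥0, ∀ f : ℝ → ℂ, AEStronglyMeasurable f volume →
      ∫⁻ q, ‖f q‖ₑ * ENNReal.ofReal (Real.exp (-β * q ^ 2)) ≤ C * eLpNorm f r volume := by
  set g : ℝ → ENNReal := fun q => ENNReal.ofReal (Real.exp (-β * q ^ 2)) with hg
  have hgm : Measurable g := by fun_prop
  -- The Gaussian weight becomes the density of a finite measure. There the L¹ norm is controlled by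
  -- the L^r norm, and the density being at most 1 returns to Lebesgue measure.
  set μ : Measure ℝ := volume.withDensity g with hμ
  have hfin : μ Set.univ ≠ ⊤ := by
    rw [hμ, withDensity_apply _ MeasurableSet.univ, Measure.restrict_univ]
    exact (integrable_exp_neg_mul_sq hβ).lintegral_lt_top.ne
  have hle : μ ≤ volume := by
    calc μ ≤ volume.withDensity 1 := withDensity_mono (Eventually.of_forall fun q => by
          simp only [hg, Pi.one_apply]
          rw [ENNReal.ofReal_le_one, Real.exp_le_one_iff]
          nlinarith [sq_nonneg q])
      _ = volume := withDensity_one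
  have hexp : 0 ≤ 1 / (1 : ENNReal).toReal - 1 / r.toReal := by
    rcases eq_or_ne r ⊤ with rfl | htop
    · simp
    · have : 1 ≤ r.toReal := by
        rw [← ENNReal.toReal_one]; exact (ENNReal.toReal_le_toReal (by simp) htop).2 hr
      simp only [ENNReal.toReal_one, div_one, sub_nonneg, one_div]
      exact inv_le_one_of_one_le₀ this
  refine ⟨(μ Set.univ ^ (1 / (1 : ENNReal).toReal - 1 / r.toReal)).toNNReal, fun f hf => ?_⟩
  rw [ENNReal.coe_toNNReal (ENNReal.rpow_ne_top_of_nonneg hexp hfin)]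
  have hfμ : AEStronglyMeasurable f μ := hf.mono_ac (withDensity_absolutelyContinuous _ _)
  calc ∫⁻ q, ‖f q‖ₑ * g q = ∫⁻ q, ‖f q‖ₑ ∂μ := by
        rw [hμ, lintegral_withDensity_eq_lintegral_mul₀ hgm.aemeasurable hf.enorm]
        simp only [Pi.mul_apply, mul_comm]
    _ = eLpNorm f 1 μ := eLpNorm_one_eq_lintegral_enorm.symm
    _ ≤ eLpNorm f r μ * μ Set.univ ^ (1 / (1 : ENNReal).toReal - 1 / r.toReal) :=
        eLpNorm_le_eLpNorm_mul_rpow_measure_univ hr hfμ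
    _ ≤ _ := by
        rw [mul_comm]
        gcongr

theorem integrable_gaussian_mul {β : ℝ} (hβ : 0 < β) {r : ENNReal} (hr : 1 ≤ r) {f : ℝ → ℂ}
    (hf : MemLp f r volume) : Integrable (fun q => Real.exp (-β * q ^ 2) * ‖f q‖) := by
  obtain ⟨C, hC⟩ := exists_lintegral_gaussian_le hβ hr
  refine ⟨(by fun_prop : Continuous fun q : ℝ => Real.exp (-β * q ^ 2)).aestronglyMeasurable.mul
    hf.1.norm, ?_⟩
  rw [HasFiniteIntegral]
  refine lt_of_le_of_lt ?_ (lt_of_le_of_lt (hC f hf.1)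
    (ENNReal.mul_lt_top ENNReal.coe_lt_top hf.2))
  refine lintegral_mono fun q => ?_
  rw [enorm_mul, enorm_norm, mul_comm, Real.enorm_of_nonneg (Real.exp_pos _).le]

end

/-! ### Averages of weighted translates in L^r. -/

section Averages

variable {r : ENNReal}

theorem eLpNorm_rpow_toReal {X : Type*} [MeasurableSpace X] (μ : Measure X) (hr : 1 ≤ r)
    (hr' : r ≠ ⊤) (f : X → ℂ) :
    eLpNorm f r μ ^ r.toReal = ∫⁻ x, ‖f x‖ₑ ^ r.toReal ∂μ := by
  have h0 : r ≠ 0 := (one_pos.trans_le hr).ne'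
  rw [eLpNorm_eq_lintegral_rpow_enorm_toReal h0 hr', ← ENNReal.rpow_mul,
    one_div_mul_cancel (ENNReal.toReal_pos h0 hr').ne', ENNReal.rpow_one]

/-- On a probability space the L¹ norm is at most the L^r norm; apply this for each x and exchange
the integrals by Tonelli. -/
theorem eLpNorm_rpow_le_lintegral_of_le {X Y : Type*} [MeasurableSpace X] [MeasurableSpace Y]
    {μ : Measure X} [SFinite μ] {ν : Measure Y} [IsProbabilityMeasure ν] (hr : 1 ≤ r)
    (hr' : r ≠ ⊤) {g : X → ℂ} {F : X → Y → ℂ} (hF : StronglyMeasurable (Function.uncurry F))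
    (hg : ∀ x, ‖g x‖ₑ ≤ ∫⁻ y, ‖F x y‖ₑ ∂ν) :
    eLpNorm g r μ ^ r.toReal ≤ ∫⁻ y, eLpNorm (fun x => F x y) r μ ^ r.toReal ∂ν := by
  simp only [eLpNorm_rpow_toReal μ hr hr']
  rw [lintegral_lintegral_swap]
  · refine lintegral_mono fun x => ?_
    rw [← eLpNorm_rpow_toReal ν hr hr']
    gcongr
    refine (hg x).trans ?_
    rw [← eLpNorm_one_eq_lintegral_enorm]
    exact eLpNorm_le_eLpNorm_of_exponent_le hr
      (hF.comp_measurable measurable_prodMk_left).aestronglyMeasurable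
  · exact ((hF.comp_measurable measurable_swap).enorm.pow_const _).aemeasurable

/-- No integrability is required: if G is not integrable, then neither is G - a on a probability
space, and the right side is infinite. -/
theorem enorm_integral_sub_const_le {Y : Type*} [MeasurableSpace Y] {ν : Measure Y}
    [IsProbabilityMeasure ν] {G : Y → ℂ} (hG : AEStronglyMeasurable G ν) (a : ℂ) :
    ‖∫ y, G y ∂ν - a‖ₑ ≤ ∫⁻ y, ‖G y - a‖ₑ ∂ν := by
  by_cases h : Integrable G ν
  · have : ∫ y, G y ∂ν - a = ∫ y, (G y - a) ∂ν := by
      rw [integral_sub h (integrable_const a)]; simp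
    rw [this]
    exact enorm_integral_le_lintegral_enorm _
  · suffices ∫⁻ y, ‖G y - a‖ₑ ∂ν = ⊤ by rw [this]; exact le_top
    by_contra hne
    have h1 : Integrable (fun y => G y - a) ν :=
      ⟨hG.sub aestronglyMeasurable_const, lt_top_iff_ne_top.2 hne⟩
    refine h ((h1.add (integrable_const a)).congr (Eventually.of_forall fun y => ?_))
    simp

theorem tendsto_eLpNorm_comp_sub (hr : 1 ≤ r) (hr' : r ≠ ⊤) {f : ℝ → ℂ}
    (hf : MemLp f r volume) :
    Tendsto (fun a : ℝ => eLpNorm (fun p => f (p - a) - f p) r volume) (𝓝 0) (𝓝 0) := by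
  have : Fact (1 ≤ r) := ⟨hr⟩
  -- Currying makes a ↦ (x ↦ x - a) continuous into the compact-open topology, as needed for
  -- continuity of composition in L^r.
  let g : C(ℝ, C(ℝ, ℝ)) := (ContinuousMap.mk (fun x : ℝ × ℝ => x.2 - x.1) (by fun_prop)).curry
  have hg : ∀ a, MeasurePreserving (g a) volume volume := fun a => measurePreserving_sub_right _ a
  have h := Filter.Tendsto.compMeasurePreservingLp (tendsto_const_nhds (x := hf.toLp f))
    (g.continuous.tendsto 0) hg (hg 0) hr'
  rw [Lp.tendsto_Lp_iff_tendsto_eLpNorm'] at h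
  refine h.congr fun a => eLpNorm_congr_ae ?_
  rw [Lp.toLp_compMeasurePreserving hf (hg a), Lp.toLp_compMeasurePreserving hf (hg 0)]
  filter_upwards [(hf.comp_measurePreserving (hg a)).coeFn_toLp,
    (hf.comp_measurePreserving (hg 0)).coeFn_toLp] with x h1 h2
  simp only [Pi.sub_apply, h1, h2]
  simp [g]

theorem tendsto_eLpNorm_mul_of_bounded {ι : Type*} {l : Filter ι} [l.IsCountablyGenerated]
    (hr : 1 ≤ r) (hr' : r ≠ ⊤) {f : ℝ → ℂ} (hf : MemLp f r volume) {m : ι → ℝ → ℂ}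
    (hm : ∀ᶠ i in l, Measurable (m i)) (hb : ∀ᶠ i in l, ∀ p, ‖m i p‖ ≤ 2)
    (hlim : ∀ p, Tendsto (fun i => m i p) l (𝓝 0)) :
    Tendsto (fun i => eLpNorm (fun p => m i p * f p) r volume) l (𝓝 0) := by
  have hr0 : 0 < r.toReal := ENNReal.toReal_pos (one_pos.trans_le hr).ne' hr'
  suffices Tendsto (fun i => eLpNorm (fun p => m i p * f p) r volume ^ r.toReal) l (𝓝 0) by
    have h2 := (ENNReal.continuous_rpow_const (y := r.toReal⁻¹)).tendsto 0 |>.comp this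
    simp only [ENNReal.zero_rpow_of_pos (inv_pos.2 hr0)] at h2
    refine h2.congr fun i => ?_
    simp only [Function.comp_apply]
    rw [← ENNReal.rpow_mul, mul_inv_cancel₀ hr0.ne', ENNReal.rpow_one]
  simp only [eLpNorm_rpow_toReal volume hr hr']
  have h0 : (0 : ENNReal) = ∫⁻ _ : ℝ, 0 ∂volume := by simp
  rw [h0]
  refine tendsto_lintegral_filter_of_dominated_convergence'
    (fun p => (2 * ‖f p‖ₑ) ^ r.toReal) ?_ ?_ ?_ ?_
  · filter_upwards [hm] with i hi
    exact (hi.aestronglyMeasurable.mul hf.1).enorm.pow_const _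
  · filter_upwards [hb] with i hi
    refine Eventually.of_forall fun p => ?_
    rw [enorm_mul]
    gcongr
    have := hi p
    rw [← enorm_norm, Real.enorm_of_nonneg (norm_nonneg _)]
    exact ENNReal.ofReal_le_of_le_toReal (by simpa using this)
  · simp only [ENNReal.mul_rpow_of_nonneg _ _ hr0.le]
    rw [lintegral_const_mul' _ _ (by simp), ← eLpNorm_rpow_toReal volume hr hr']
    exact ENNReal.mul_ne_top (by simp) (ENNReal.rpow_ne_top_of_nonneg hr0.le hf.2.ne)
  · refine Eventually.of_forall fun p => ?_
    have h1 : Tendsto (fun i => ‖m i p * f p‖ₑ) l (𝓝 0) := by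
      have := ((hlim p).mul_const (f p)).enorm
      simpa using this
    have h2 := (ENNReal.continuous_rpow_const (y := r.toReal)).tendsto 0 |>.comp h1
    simpa [Function.comp_def, ENNReal.zero_rpow_of_pos hr0] using h2

theorem eLpNorm_average_le {ν : Measure ℝ} [IsProbabilityMeasure ν] (hr : 1 ≤ r) (hr' : r ≠ ⊤)
    {f : ℝ → ℂ} (hf : StronglyMeasurable f) (hfr : MemLp f r volume) {m : ℝ → ℝ → ℂ}
    (hm : Continuous (Function.uncurry m)) (hm1 : ∀ p y, ‖m p y‖ ≤ 1) (ε : ℝ) :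
    eLpNorm (fun p => ∫ y, m p y * f (p - ε * y) ∂ν) r volume ≤ eLpNorm f r volume := by
  have hr0 : 0 < r.toReal := ENNReal.toReal_pos (one_pos.trans_le hr).ne' hr'
  rw [← ENNReal.rpow_le_rpow_iff hr0]
  have hF : StronglyMeasurable (Function.uncurry fun p y => m p y * f (p - ε * y)) :=
    hm.stronglyMeasurable.mul (hf.comp_measurable (by fun_prop))
  refine (eLpNorm_rpow_le_lintegral_of_le hr hr' (ν := ν) hF
    (fun p => enorm_integral_le_lintegral_enorm _)).trans ?_
  calc _ ≤ ∫⁻ _, eLpNorm f r volume ^ r.toReal ∂ν := by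
        refine lintegral_mono fun y => ?_
        gcongr
        calc eLpNorm (fun p => m p y * f (p - ε * y)) r volume
            ≤ eLpNorm (fun p => f (p - ε * y)) r volume := by
              refine eLpNorm_mono fun p => ?_
              rw [norm_mul]
              exact mul_le_of_le_one_left (norm_nonneg _) (hm1 p y)
          _ = eLpNorm f r volume :=
              eLpNorm_comp_measurePreserving hfr.1 (measurePreserving_sub_right volume (ε * y))
    _ = _ := by simp

/-- For fixed y, m f(· - εy) - f = m (f(· - εy) - f) + (m - 1) f: the first part vanishes by
continuity of translations, the second by dominated convergence. The bound (2‖f‖)^r, constant in y,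
then lets the limit pass under the average. -/
theorem tendsto_eLpNorm_average_sub {ι : Type*} {l : Filter ι} [l.IsCountablyGenerated]
    {ν : Measure ℝ} [IsProbabilityMeasure ν] (hr : 1 ≤ r) (hr' : r ≠ ⊤)
    {f : ℝ → ℂ} (hf : StronglyMeasurable f) (hfr : MemLp f r volume) {m : ι → ℝ → ℝ → ℂ}
    (hm : ∀ i, Continuous (Function.uncurry (m i))) (hm1 : ∀ᶠ i in l, ∀ p y, ‖m i p y‖ ≤ 1)
    (hlim : ∀ p y, Tendsto (fun i => m i p y) l (𝓝 1)) {ε : ι → ℝ} (hε : Tendsto ε l (𝓝 0)) :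
    Tendsto (fun i => eLpNorm (fun p => ∫ y, m i p y * f (p - ε i * y) ∂ν - f p) r volume) l
      (𝓝 0) := by
  have hr0 : 0 < r.toReal := ENNReal.toReal_pos (one_pos.trans_le hr).ne' hr'
  have hF (i : ι) : StronglyMeasurable
      (Function.uncurry fun p y => m i p y * f (p - ε i * y) - f p) :=
    ((hm i).stronglyMeasurable.mul (hf.comp_measurable (by fun_prop))).sub
      (hf.comp_measurable measurable_fst)
  have htr : ∀ a : ℝ, eLpNorm (fun p => f (p - a)) r volume = eLpNorm f r volume := fun a =>
    eLpNorm_comp_measurePreserving hfr.1 (measurePreserving_sub_right volume a)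
  have hmtr : ∀ a : ℝ, AEStronglyMeasurable (fun p => f (p - a)) volume := fun a =>
    (hf.comp_measurable (by fun_prop)).aestronglyMeasurable
  have hmy : ∀ i y, Continuous (fun p => m i p y) := fun i y =>
    (hm i).comp (by fun_prop : Continuous fun p : ℝ => (p, y))
  have key : Tendsto (fun i => ∫⁻ y, eLpNorm (fun p => m i p y * f (p - ε i * y) - f p) r volume
      ^ r.toReal ∂ν) l (𝓝 (∫⁻ _, 0 ∂ν)) := by
    refine tendsto_lintegral_filter_of_dominated_convergence
      (fun _ => (2 * eLpNorm f r volume) ^ r.toReal) (Eventually.of_forall fun i => ?_) ?_ ?_ ?_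
    · simp only [eLpNorm_rpow_toReal volume hr hr']
      exact ((hF i).enorm.pow_const _).lintegral_prod_left'
    · filter_upwards [hm1] with i hi
      refine Eventually.of_forall fun y => ?_
      gcongr
      refine (eLpNorm_sub_le ((hmy i y).aestronglyMeasurable.mul (hmtr _)) hfr.1 hr).trans ?_
      rw [two_mul]
      gcongr
      rw [← htr (ε i * y)]
      refine eLpNorm_mono fun p => ?_
      rw [Pi.mul_apply, norm_mul]
      exact mul_le_of_le_one_left (norm_nonneg _) (hi p y)
    · simp only [lintegral_const, measure_univ, mul_one]
      exact ENNReal.rpow_ne_top_of_nonneg hr0.le (ENNReal.mul_ne_top (by simp) hfr.2.ne)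
    · refine Eventually.of_forall fun y => ?_
      have h1 : Tendsto (fun i => eLpNorm (fun p => f (p - ε i * y) - f p) r volume) l (𝓝 0) :=
        (tendsto_eLpNorm_comp_sub hr hr' hfr).comp (by simpa using hε.mul_const y)
      have h2 : Tendsto (fun i => eLpNorm (fun p => (m i p y - 1) * f p) r volume) l (𝓝 0) := by
        refine tendsto_eLpNorm_mul_of_bounded hr hr' hfr
          (Eventually.of_forall fun i => ((hmy i y).sub continuous_const).measurable) ?_ ?_
        · filter_upwards [hm1] with i hi p
          calc ‖m i p y - 1‖ ≤ ‖m i p y‖ + ‖(1 : ℂ)‖ := norm_sub_le _ _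
            _ ≤ 1 + 1 := by rw [norm_one]; gcongr; exact hi p y
            _ = 2 := by norm_num
        · intro p
          simpa using (hlim p y).sub_const 1
      have h3 : Tendsto (fun i => eLpNorm (fun p => m i p y * f (p - ε i * y) - f p) r volume) l
          (𝓝 0) := by
        refine tendsto_of_tendsto_of_tendsto_of_le_of_le' tendsto_const_nhds
          (by simpa using h1.add h2) (Eventually.of_forall fun i => zero_le) ?_
        filter_upwards [hm1] with i hi
        have e : (fun p => m i p y * f (p - ε i * y) - f p) =
            (fun p => m i p y * (f (p - ε i * y) - f p)) + fun p => (m i p y - 1) * f p := by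
          ext p; simp only [Pi.add_apply]; ring
        rw [e]
        refine (eLpNorm_add_le ((hmy i y).aestronglyMeasurable.mul ((hmtr _).sub hfr.1))
          (((hmy i y).sub continuous_const).aestronglyMeasurable.mul hfr.1) hr).trans ?_
        refine add_le_add (eLpNorm_mono fun p => ?_) le_rfl
        rw [Pi.mul_apply, norm_mul]
        exact mul_le_of_le_one_left (norm_nonneg _) (hi p y)
      have h4 := (ENNReal.continuous_rpow_const (y := r.toReal)).tendsto 0 |>.comp h3
      simpa [Function.comp_def, ENNReal.zero_rpow_of_pos hr0] using h4
  rw [lintegral_zero] at key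
  have h5 : Tendsto (fun i => eLpNorm (fun p => ∫ y, m i p y * f (p - ε i * y) ∂ν - f p) r volume
      ^ r.toReal) l (𝓝 0) :=
    tendsto_of_tendsto_of_tendsto_of_le_of_le tendsto_const_nhds key (fun i => zero_le)
      (fun i => eLpNorm_rpow_le_lintegral_of_le hr hr' (hF i) fun p =>
        enorm_integral_sub_const_le (StronglyMeasurable.aestronglyMeasurable
          (((hm i).comp (by fun_prop : Continuous fun y : ℝ => (p, y))).stronglyMeasurable.mul
            (hf.comp_measurable (by fun_prop)))) _)
  have h2 := (ENNReal.continuous_rpow_const (y := r.toReal⁻¹)).tendsto 0 |>.comp h5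
  simp only [ENNReal.zero_rpow_of_pos (inv_pos.2 hr0)] at h2
  refine h2.congr fun i => ?_
  simp only [Function.comp_apply]
  rw [← ENNReal.rpow_mul, mul_inv_cancel₀ hr0.ne', ENNReal.rpow_one]

end Averages

/-! ### Existence: the evolution with the Gaussian kernel is a solution. -/

section

section GaussianDominated

/-- A kernel `G t p q` that is continuous for `t > 0` and dominated by a Gaussian in `q`, uniformly
for `(t, p)` in compact boxes. -/
structure GaussianDominated (G : ℝ → ℝ → ℝ → ℂ) : Prop where
  continuousOn : ContinuousOn (fun x : ℝ × ℝ × ℝ => G x.1 x.2.1 x.2.2) (Set.Ioi 0 ×ˢ Set.univ)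
  bound : ∀ t₁ t₂ M : ℝ, 0 < t₁ → ∃ C β : ℝ, 0 < β ∧ ∀ t ∈ Set.Icc t₁ t₂, ∀ p : ℝ, |p| ≤ M →
    ∀ q : ℝ, ‖G t p q‖ ≤ C * Real.exp (-β * q ^ 2)

namespace GaussianDominated

variable {G G' : ℝ → ℝ → ℝ → ℂ} {r : ENNReal} {f : ℝ → ℂ}

theorem continuous_right (hG : GaussianDominated G) {t : ℝ} (ht : 0 < t) (p : ℝ) :
    Continuous (G t p) := by
  rw [← continuousOn_univ]
  exact hG.continuousOn.comp (f := fun q => (t, p, q)) (by fun_prop) fun q _ => ⟨ht, trivial⟩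

/-- An integrable function dominating `q ↦ G t p q * f q` for `(t, p)` in a box. -/
theorem exists_integrable_bound (hG : GaussianDominated G) (hr : 1 ≤ r) (hf : MemLp f r volume)
    {t₁ : ℝ} (t₂ M : ℝ) (ht₁ : 0 < t₁) : ∃ g : ℝ → ℝ, Integrable g ∧
      ∀ t ∈ Set.Icc t₁ t₂, ∀ p : ℝ, |p| ≤ M → ∀ q : ℝ, ‖G t p q * f q‖ ≤ g q := by
  obtain ⟨C, β, hβ, hC⟩ := hG.bound t₁ t₂ M ht₁
  refine ⟨fun q => C * (Real.exp (-β * q ^ 2) * ‖f q‖),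
    (integrable_gaussian_mul hβ hr hf).const_mul C, fun t ht p hp q => ?_⟩
  rw [norm_mul]
  beta_reduce
  rw [← mul_assoc]
  gcongr
  exact hC t ht p hp q

theorem aestronglyMeasurable (hG : GaussianDominated G) (hf : AEStronglyMeasurable f volume)
    {t : ℝ} (ht : 0 < t) (p : ℝ) : AEStronglyMeasurable (fun q => G t p q * f q) volume :=
  (hG.continuous_right ht p).aestronglyMeasurable.mul hf

theorem integrable (hG : GaussianDominated G) (hr : 1 ≤ r) (hf : MemLp f r volume)
    {t : ℝ} (ht : 0 < t) (p : ℝ) : Integrable (fun q => G t p q * f q) := by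
  obtain ⟨g, hg, hgb⟩ := hG.exists_integrable_bound hr hf t |p| ht
  exact hg.mono' (hG.aestronglyMeasurable hf.1 ht p)
    (Eventually.of_forall fun q => hgb t ⟨le_rfl, le_rfl⟩ p le_rfl q)

theorem continuousOn_integral (hG : GaussianDominated G) (hr : 1 ≤ r) (hf : MemLp f r volume) :
    ContinuousOn (fun x : ℝ × ℝ => ∫ q, G x.1 x.2 q * f q) (Set.Ioi 0 ×ˢ Set.univ) := by
  rintro ⟨t, p⟩ ⟨ht, -⟩
  have ht : 0 < t := ht
  obtain ⟨g, hg, hgb⟩ := hG.exists_integrable_bound hr hf (2 * t) (|p| + 1) (half_pos ht)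
  have hn : Set.Icc (t / 2) (2 * t) ×ˢ Metric.closedBall p 1 ∈ 𝓝 (t, p) :=
    prod_mem_nhds (Icc_mem_nhds (by linarith) (by linarith))
      (Metric.closedBall_mem_nhds p one_pos)
  refine (continuousAt_of_dominated (bound := g) ?_ ?_ hg ?_).continuousWithinAt
  · filter_upwards [hn] with x hx
    exact hG.aestronglyMeasurable hf.1 ((half_pos ht).trans_le hx.1.1) x.2
  · filter_upwards [hn] with x hx
    refine Eventually.of_forall fun q => hgb x.1 hx.1 x.2 ?_ q
    have := hx.2
    rw [Metric.mem_closedBall, Real.dist_eq] at this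
    have := abs_sub_abs_le_abs_sub x.2 p
    linarith
  · refine Eventually.of_forall fun q => ContinuousAt.mul ?_ continuousAt_const
    have h1 : ContinuousAt (fun x : ℝ × ℝ × ℝ => G x.1 x.2.1 x.2.2) (t, p, q) :=
      hG.continuousOn.continuousAt (prod_mem_nhds (Ioi_mem_nhds ht) univ_mem)
    exact ContinuousAt.comp (f := fun x : ℝ × ℝ => (x.1, x.2, q)) (x := (t, p)) h1 (by fun_prop)

theorem hasDerivAt_integral_space (hG : GaussianDominated G) (hG' : GaussianDominated G')
    (hr : 1 ≤ r) (hf : MemLp f r volume) {t : ℝ} (ht : 0 < t)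
    (hd : ∀ p q, HasDerivAt (fun x => G t x q) (G' t p q) p) (p : ℝ) :
    HasDerivAt (fun x => ∫ q, G t x q * f q) (∫ q, G' t p q * f q) p := by
  obtain ⟨g, hg, hgb⟩ := hG'.exists_integrable_bound hr hf t (|p| + 1) ht
  refine (hasDerivAt_integral_of_dominated_loc_of_deriv_le (bound := g)
    (Metric.closedBall_mem_nhds p one_pos)
    (Eventually.of_forall fun x => hG.aestronglyMeasurable hf.1 ht x)
    (hG.integrable hr hf ht p) (hG'.aestronglyMeasurable hf.1 ht p)
    (Eventually.of_forall fun q x hx => hgb t ⟨le_rfl, le_rfl⟩ x ?_ q) hg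
    (Eventually.of_forall fun q x _ => (hd x q).mul_const (f q))).2
  rw [Metric.mem_closedBall, Real.dist_eq] at hx
  have := abs_sub_abs_le_abs_sub x p
  linarith

theorem hasDerivAt_integral_time (hG : GaussianDominated G) (hG' : GaussianDominated G')
    (hr : 1 ≤ r) (hf : MemLp f r volume) {t : ℝ} (ht : 0 < t) (p : ℝ)
    (hd : ∀ s > 0, ∀ q, HasDerivAt (fun x => G x p q) (G' s p q) s) :
    HasDerivAt (fun x => ∫ q, G x p q * f q) (∫ q, G' t p q * f q) t := by
  obtain ⟨g, hg, hgb⟩ := hG'.exists_integrable_bound hr hf (2 * t) |p| (half_pos ht)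
  refine (hasDerivAt_integral_of_dominated_loc_of_deriv_le (bound := g)
    (Icc_mem_nhds (by linarith : t / 2 < t) (by linarith : t < 2 * t)) ?_
    (hG.integrable hr hf ht p) (hG'.aestronglyMeasurable hf.1 ht p)
    (Eventually.of_forall fun q x hx => hgb x hx p le_rfl q) hg
    (Eventually.of_forall fun q x hx =>
      (hd x ((half_pos ht).trans_le hx.1) q).mul_const (f q))).2
  filter_upwards [Ioi_mem_nhds ht] with x hx
  exact hG.aestronglyMeasurable hf.1 hx p

end GaussianDominated

end GaussianDominated

/-- The evolution with kernel `mehlerKernel`. -/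
def mehlerEvolution (α b c d : ℝ → ℝ) (f : ℝ → ℂ) (t p : ℝ) : ℂ :=
  ∫ q, mehlerKernel α b c d t p q * f q

/-- The factor of the kernel that tends to `1` as `t → 0`, in the variable `y` with
`q = p - y / √(2 b)`. -/
def mehlerWeight (α b c d : ℝ → ℝ) (t p y : ℝ) : ℂ :=
  (α t : ℂ) * Complex.exp (((-c t * (2 * p - (√(2 * b t))⁻¹ * y) ^ 2 : ℝ) : ℂ) +
    Complex.I * ((d t * (2 * p - (√(2 * b t))⁻¹ * y) : ℝ) : ℂ))

variable {D v e : ℝ} {α b c d : ℝ → ℝ}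

theorem continuous_mehlerWeight (t : ℝ) :
    Continuous (Function.uncurry (mehlerWeight α b c d t)) := by
  unfold mehlerWeight Function.uncurry
  fun_prop

theorem norm_mehlerWeight_le {t : ℝ} (hα : 0 ≤ α t) (hα' : α t ≤ 1) (hc : 0 ≤ c t) (p y : ℝ) :
    ‖mehlerWeight α b c d t p y‖ ≤ 1 := by
  unfold mehlerWeight
  rw [norm_mul, Complex.norm_exp, Complex.norm_real, Real.norm_of_nonneg hα, Complex.add_re,
    Complex.ofReal_re, Complex.I_mul_re, Complex.ofReal_im, neg_zero, add_zero]
  refine mul_le_one₀ hα' (Real.exp_pos _).le (Real.exp_le_one_iff.2 ?_)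
  rw [neg_mul]
  exact neg_nonpos.2 (mul_nonneg hc (sq_nonneg _))

/-- The substitution q = p - y/√(2b) turns √(b/π) exp(-b(p - q)²) dq into the standard normal law;
what remains of the kernel is the weight. -/
theorem integral_mehlerKernel_mul {t : ℝ} (hb : 0 < b t) (f : ℝ → ℂ) (p : ℝ) :
    ∫ q, mehlerKernel α b c d t p q * f q =
      ∫ y, mehlerWeight α b c d t p y * f (p - (√(2 * b t))⁻¹ * y)
        ∂(ProbabilityTheory.gaussianReal 0 1) := by
  set ε := (√(2 * b t))⁻¹ with hε
  have h2b : 0 < 2 * b t := by positivity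
  have hε0 : 0 < ε := inv_pos.2 (Real.sqrt_pos.2 h2b)
  have hbε : b t * ε ^ 2 = 1 / 2 := by
    rw [hε, inv_pow, Real.sq_sqrt h2b.le]; field_simp
  have hs : ε * √(b t / Real.pi) = (√(2 * Real.pi))⁻¹ := by
    rw [hε, ← Real.sqrt_inv, ← Real.sqrt_inv, ← Real.sqrt_mul (by positivity)]
    congr 1
    field_simp
  rw [ProbabilityTheory.integral_gaussianReal_eq_integral_smul one_ne_zero]
  have h1 : ∀ y, ProbabilityTheory.gaussianPDFReal 0 1 y •
      (mehlerWeight α b c d t p y * f (p - ε * y)) =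
      (ε : ℂ) * (mehlerKernel α b c d t p (p - ε * y) * f (p - ε * y)) := by
    intro y
    rw [Complex.real_smul, ← mul_assoc, ← mul_assoc]
    congr 1
    have e1 : ((-(b t * (p - (p - ε * y)) ^ 2) - c t * (p + (p - ε * y)) ^ 2 : ℝ) : ℂ) +
        Complex.I * ((d t * (p + (p - ε * y)) : ℝ) : ℂ) = ((-(y ^ 2 / 2) : ℝ) : ℂ) +
        (((-c t * (2 * p - ε * y) ^ 2 : ℝ) : ℂ) +
          Complex.I * ((d t * (2 * p - ε * y) : ℝ) : ℂ)) := by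
      rw [show -(b t * (p - (p - ε * y)) ^ 2) - c t * (p + (p - ε * y)) ^ 2 =
        -(b t * ε ^ 2 * y ^ 2) + -c t * (2 * p - ε * y) ^ 2 by ring, hbε]
      push_cast
      ring
    rw [mehlerKernel, mehlerWeight, ← hε, e1, Complex.exp_add ((-(y ^ 2 / 2) : ℝ) : ℂ), ProbabilityTheory.gaussianPDFReal,
      ← Complex.ofReal_exp]
    rw [show (√(2 * Real.pi * ((1 : ℝ≥0) : ℝ)))⁻¹ = ε * √(b t / Real.pi) by
      rw [hs, NNReal.coe_one, mul_one]]
    rw [show -(y - 0) ^ 2 / (2 * ((1 : ℝ≥0) : ℝ)) = -(y ^ 2 / 2) by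
      rw [NNReal.coe_one]; ring]
    generalize Complex.exp (_ + _) = Z
    rw [Complex.ofReal_mul (α t), Complex.ofReal_mul, Complex.ofReal_mul]
    ring
  simp only [h1]
  rw [integral_const_mul,
    Measure.integral_comp_mul_left (fun z => mehlerKernel α b c d t p (p - z) * f (p - z)) ε,
    integral_sub_left_eq_self (fun z => mehlerKernel α b c d t p z * f z) volume p,
    abs_of_pos (inv_pos.2 hε0), Complex.real_smul, ← mul_assoc, ← Complex.ofReal_mul,
    mul_inv_cancel₀ hε0.ne', Complex.ofReal_one, one_mul]

namespace MehlerCoefficients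

variable {r : ENNReal} {f : ℝ → ℂ}

theorem gaussianDominated (h : MehlerCoefficients D v e α b c d) :
    GaussianDominated (mehlerKernel α b c d) where
  continuousOn := h.continuousOn_mehlerKernel
  bound t₁ t₂ M ht := by
    obtain ⟨C, β, -, hβ, hC⟩ := h.exists_gaussian_bound t₂ M ht
    exact ⟨C, β, hβ, fun t ht p hp q => (hC t ht p hp q).1⟩

theorem gaussianDominatedD (h : MehlerCoefficients D v e α b c d) :
    GaussianDominated (mehlerKernelD α b c d) where
  continuousOn := h.continuousOn_mehlerKernelD
  bound t₁ t₂ M ht := by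
    obtain ⟨C, β, -, hβ, hC⟩ := h.exists_gaussian_bound t₂ M ht
    exact ⟨C, β, hβ, fun t ht p hp q => (hC t ht p hp q).2.1⟩

theorem gaussianDominatedDD (h : MehlerCoefficients D v e α b c d) :
    GaussianDominated (mehlerKernelDD α b c d) where
  continuousOn := h.continuousOn_mehlerKernelDD
  bound t₁ t₂ M ht := by
    obtain ⟨C, β, -, hβ, hC⟩ := h.exists_gaussian_bound t₂ M ht
    exact ⟨C, β, hβ, fun t ht p hp q => (hC t ht p hp q).2.2.2.1⟩

theorem gaussianDominatedT (h : MehlerCoefficients D v e α b c d) :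
    GaussianDominated (mehlerKernelT D v e α b c d) where
  continuousOn := h.continuousOn_mehlerKernelT
  bound t₁ t₂ M ht := by
    obtain ⟨C, β, -, hβ, hC⟩ := h.exists_gaussian_bound t₂ M ht
    exact ⟨C, β, hβ, fun t ht p hp q => (hC t ht p hp q).2.2.2.2⟩

theorem hasDerivAt_mehlerEvolution (h : MehlerCoefficients D v e α b c d) (hr : 1 ≤ r)
    (hf : MemLp f r volume) {t : ℝ} (ht : 0 < t) (p : ℝ) :
    HasDerivAt (mehlerEvolution α b c d f t) (∫ q, mehlerKernelD α b c d t p q * f q) p :=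
  h.gaussianDominated.hasDerivAt_integral_space h.gaussianDominatedD hr hf ht
    (fun p q => hasDerivAt_mehlerKernel t p q) p

theorem hasDerivAt_deriv_mehlerEvolution (h : MehlerCoefficients D v e α b c d) (hr : 1 ≤ r)
    (hf : MemLp f r volume) {t : ℝ} (ht : 0 < t) (p : ℝ) :
    HasDerivAt (fun p => ∫ q, mehlerKernelD α b c d t p q * f q)
      (∫ q, mehlerKernelDD α b c d t p q * f q) p :=
  h.gaussianDominatedD.hasDerivAt_integral_space h.gaussianDominatedDD hr hf ht
    (fun p q => hasDerivAt_mehlerKernelD t p q) p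

theorem hasDerivAt_mehlerEvolution_time (h : MehlerCoefficients D v e α b c d) (hr : 1 ≤ r)
    (hf : MemLp f r volume) {t : ℝ} (ht : 0 < t) (p : ℝ) :
    HasDerivAt (fun s => mehlerEvolution α b c d f s p)
      (∫ q, mehlerKernelT D v e α b c d t p q * f q) t :=
  h.gaussianDominated.hasDerivAt_integral_time h.gaussianDominatedT hr hf ht p
    fun _ hs q => h.hasDerivAt_mehlerKernel_time hs p q

theorem integral_mehlerKernelT (h : MehlerCoefficients D v e α b c d) (hr : 1 ≤ r)
    (hf : MemLp f r volume) {t : ℝ} (ht : 0 < t) (p : ℝ) :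
    ∫ q, mehlerKernelT D v e α b c d t p q * f q =
      D * (∫ q, mehlerKernelDD α b c d t p q * f q) +
        (-(v * p ^ 2 : ℝ) + Complex.I * (e * p : ℝ)) * mehlerEvolution α b c d f t p := by
  simp only [mehlerKernelT, add_mul (_ * _) (_ * _), mul_assoc, mehlerEvolution]
  rw [integral_add ((h.gaussianDominatedDD.integrable hr hf ht p).const_mul _)
    ((h.gaussianDominated.integrable hr hf ht p).const_mul _), integral_const_mul,
    integral_const_mul]

theorem deriv_mehlerEvolution (h : MehlerCoefficients D v e α b c d) (hr : 1 ≤ r)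
    (hf : MemLp f r volume) {t : ℝ} (ht : 0 < t) :
    deriv (mehlerEvolution α b c d f t) = fun p => ∫ q, mehlerKernelD α b c d t p q * f q :=
  funext fun p => (h.hasDerivAt_mehlerEvolution hr hf ht p).deriv

theorem iteratedDeriv_two_mehlerEvolution (h : MehlerCoefficients D v e α b c d) (hr : 1 ≤ r)
    (hf : MemLp f r volume) {t : ℝ} (ht : 0 < t) :
    iteratedDeriv 2 (mehlerEvolution α b c d f t) =
      fun p => ∫ q, mehlerKernelDD α b c d t p q * f q := by
  rw [iteratedDeriv_succ, iteratedDeriv_one, h.deriv_mehlerEvolution hr hf ht]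
  exact funext fun p => (h.hasDerivAt_deriv_mehlerEvolution hr hf ht p).deriv

theorem contDiff_mehlerEvolution (h : MehlerCoefficients D v e α b c d) (hr : 1 ≤ r)
    (hf : MemLp f r volume) {t : ℝ} (ht : 0 < t) :
    ContDiff ℝ 2 (mehlerEvolution α b c d f t) := by
  have hc : ContDiff ℝ 1 (fun p => ∫ q, mehlerKernelD α b c d t p q * f q) := by
    rw [contDiff_one_iff_deriv]
    refine ⟨fun p => (h.hasDerivAt_deriv_mehlerEvolution hr hf ht p).differentiableAt, ?_⟩
    rw [funext fun p => (h.hasDerivAt_deriv_mehlerEvolution hr hf ht p).deriv, ← continuousOn_univ]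
    exact (h.gaussianDominatedDD.continuousOn_integral hr hf).comp (f := fun p => (t, p))
      (by fun_prop) fun p _ => ⟨ht, trivial⟩
  rw [show (2 : WithTop ℕ∞) = 1 + 1 by norm_num, contDiff_succ_iff_deriv]
  refine ⟨fun p => (h.hasDerivAt_mehlerEvolution hr hf ht p).differentiableAt, by simp, ?_⟩
  rwa [h.deriv_mehlerEvolution hr hf ht]

theorem eLpNorm_mehlerEvolution_le (h : MehlerCoefficients D v e α b c d) (hr : 1 ≤ r)
    (hr' : r ≠ ⊤) (hf : MemLp f r volume) {t : ℝ} (ht : 0 < t) :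
    eLpNorm (mehlerEvolution α b c d f t) r volume ≤ eLpNorm f r volume := by
  -- The averaging lemmas need a strongly measurable representative for joint measurability of f(p -
  -- εy); the evolution does not see the change.
  have hae := hf.1.ae_eq_mk
  have e1 : mehlerEvolution α b c d f t = mehlerEvolution α b c d (hf.1.mk f) t := by
    ext p
    refine integral_congr_ae ?_
    filter_upwards [hae] with q hq
    rw [hq]
  rw [e1]
  refine le_of_le_of_eq ?_ (eLpNorm_congr_ae hae).symm
  have := eLpNorm_average_le (ν := ProbabilityTheory.gaussianReal 0 1) hr hr'
    hf.1.stronglyMeasurable_mk (hf.ae_eq hae) (continuous_mehlerWeight (α := α) (b := b) (c := c)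
      (d := d) t) (norm_mehlerWeight_le (h.α_nonneg t ht) (h.α_le_one t ht) (h.c_nonneg t ht))
      (√(2 * b t))⁻¹
  refine le_of_eq_of_le (congrArg (eLpNorm · r volume) (funext fun p => ?_)) this
  exact integral_mehlerKernel_mul (h.b_pos t ht) _ p

theorem tendsto_inv_sqrt (h : MehlerCoefficients D v e α b c d) :
    Tendsto (fun t => (√(2 * b t))⁻¹) (𝓝[>] 0) (𝓝 0) :=
  (Real.tendsto_sqrt_atTop.comp (h.tendsto_b.const_mul_atTop two_pos)).inv_tendsto_atTop

theorem tendsto_mehlerWeight (h : MehlerCoefficients D v e α b c d) (p y : ℝ) :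
    Tendsto (fun t => mehlerWeight α b c d t p y) (𝓝[>] 0) (𝓝 1) := by
  have h1 : Tendsto (fun t => 2 * p - (√(2 * b t))⁻¹ * y) (𝓝[>] 0) (𝓝 (2 * p)) := by
    simpa using (h.tendsto_inv_sqrt.mul_const y).const_sub (2 * p)
  have h2 : Tendsto (fun t => -c t * (2 * p - (√(2 * b t))⁻¹ * y) ^ 2) (𝓝[>] 0) (𝓝 0) := by
    simpa using h.tendsto_c.neg.mul (h1.pow 2)
  have h3 : Tendsto (fun t => d t * (2 * p - (√(2 * b t))⁻¹ * y)) (𝓝[>] 0) (𝓝 0) := by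
    simpa using h.tendsto_d.mul h1
  have hC := Complex.continuous_ofReal
  have h4 := ((hC.tendsto 1).comp h.tendsto_α).mul ((Complex.continuous_exp.tendsto _).comp
    (((hC.tendsto 0).comp h2).add (((hC.tendsto 0).comp h3).const_mul Complex.I)))
  simpa [Function.comp_def, mehlerWeight] using h4

theorem tendsto_mehlerEvolution (h : MehlerCoefficients D v e α b c d) (hr : 1 ≤ r)
    (hr' : r ≠ ⊤) (hf : MemLp f r volume) :
    Tendsto (fun t => eLpNorm (fun p => mehlerEvolution α b c d f t p - f p) r volume)
      (𝓝[>] 0) (𝓝 0) := by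
  have hae := hf.1.ae_eq_mk
  have := tendsto_eLpNorm_average_sub (ν := ProbabilityTheory.gaussianReal 0 1) hr hr'
    hf.1.stronglyMeasurable_mk (hf.ae_eq hae) (m := mehlerWeight α b c d) continuous_mehlerWeight
    (l := 𝓝[>] 0) (by
      filter_upwards [self_mem_nhdsWithin] with t ht
      exact norm_mehlerWeight_le (h.α_nonneg t ht) (h.α_le_one t ht) (h.c_nonneg t ht))
    h.tendsto_mehlerWeight h.tendsto_inv_sqrt
  refine this.congr' ?_
  filter_upwards [self_mem_nhdsWithin] with t ht
  refine eLpNorm_congr_ae ?_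
  filter_upwards [hae] with p hp
  rw [hp, ← integral_mehlerKernel_mul (h.b_pos t ht)]
  congr 1
  refine integral_congr_ae ?_
  filter_upwards [hae] with q hq
  rw [hq]

/-- The values of D, v, e are those obtained on dividing the equation by iħ. -/
theorem isSolution {ħ σ γ η : ℝ}
    (h : MehlerCoefficients (ħ * σ ^ 2 / 2) (γ ^ 2 * η ^ 2 / (2 * ħ)) (η / ħ) α b c d)
    (hħ : ħ ≠ 0) (hr : 1 ≤ r) (hr' : r ≠ ⊤) (hf : MemLp f r volume) :
    IsSolution ħ σ γ η r f (mehlerEvolution α b c d f) where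
  differentiableAt_time t ht p :=
    (h.hasDerivAt_mehlerEvolution_time hr hf ht p).differentiableAt
  contDiff_space t ht := h.contDiff_mehlerEvolution hr hf ht
  continuousOn := h.gaussianDominated.continuousOn_integral hr hf
  continuousOn_deriv_time :=
    (h.gaussianDominatedT.continuousOn_integral hr hf).congr fun x hx =>
      (h.hasDerivAt_mehlerEvolution_time hr hf hx.1 x.2).deriv
  continuousOn_deriv_space :=
    (h.gaussianDominatedD.continuousOn_integral hr hf).congr fun x hx => by
      simp only [h.deriv_mehlerEvolution hr hf hx.1]
  continuousOn_deriv_space_two :=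
    (h.gaussianDominatedDD.continuousOn_integral hr hf).congr fun x hx => by
      simp only [h.iteratedDeriv_two_mehlerEvolution hr hf hx.1]
  equation t ht p := by
    rw [(h.hasDerivAt_mehlerEvolution_time hr hf ht p).deriv, h.integral_mehlerKernelT hr hf ht,
      h.iteratedDeriv_two_mehlerEvolution hr hf ht]
    have : (ħ : ℂ) ≠ 0 := by exact_mod_cast hħ
    push_cast
    field_simp
    ring_nf
    rw [Complex.I_sq]
    ring
  memLp t ht := ⟨(h.contDiff_mehlerEvolution hr hf ht).continuous.aestronglyMeasurable,
    (h.eLpNorm_mehlerEvolution_le hr hr' hf ht).trans_lt hf.2⟩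
  bounded T := ⟨(eLpNorm f r volume).toNNReal, fun t ht => by
    rw [ENNReal.coe_toNNReal hf.2.ne]
    exact h.eLpNorm_mehlerEvolution_le hr hr' hf ht.1⟩
  initial := h.tendsto_mehlerEvolution hr hr' hf

end MehlerCoefficients

end

/-! ### Uniqueness by duality with the backward kernel. -/

theorem exists_integral_gaussian_mul_norm_le {β : ℝ} (hβ : 0 < β) {r : ENNReal} (hr : 1 ≤ r) :
    ∃ C : ℝ, 0 ≤ C ∧ ∀ f : ℝ → ℂ, MemLp f r volume →
      ∫ q, Real.exp (-β * q ^ 2) * ‖f q‖ ≤ C * (eLpNorm f r volume).toReal := by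
  obtain ⟨C, hC⟩ := exists_lintegral_gaussian_le hβ hr
  refine ⟨C, C.2, fun f hf => ?_⟩
  rw [integral_eq_lintegral_of_nonneg_ae (Eventually.of_forall fun q => by positivity)
    (integrable_gaussian_mul hβ hr hf).1, ← ENNReal.coe_toReal, ← ENNReal.toReal_mul]
  refine ENNReal.toReal_mono (ENNReal.mul_ne_top ENNReal.coe_ne_top hf.2.ne)
    (le_of_eq_of_le (lintegral_congr fun q => ?_) (hC f hf.1))
  rw [mul_comm, ENNReal.ofReal_mul (norm_nonneg _), ofReal_norm]

/-- Differentiation under the integral sign for integrands with fixed compact support. -/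
theorem hasDerivAt_integral_of_compact_support {F F' : ℝ → ℝ → ℂ} {S : Set ℝ} (hS : IsCompact S)
    {U : Set ℝ} (hU : IsOpen U)
    (hF : ContinuousOn (fun x : ℝ × ℝ => F x.1 x.2) (U ×ˢ Set.univ))
    (hF' : ContinuousOn (fun x : ℝ × ℝ => F' x.1 x.2) (U ×ˢ Set.univ))
    (hFS : ∀ s, ∀ q ∉ S, F s q = 0) (hFS' : ∀ s, ∀ q ∉ S, F' s q = 0)
    (hd : ∀ s ∈ U, ∀ q, HasDerivAt (fun s => F s q) (F' s q) s) {s : ℝ} (hs : s ∈ U) :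
    HasDerivAt (fun s => ∫ q, F s q) (∫ q, F' s q) s := by
  have hcont : ∀ {G : ℝ → ℝ → ℂ}, ContinuousOn (fun x : ℝ × ℝ => G x.1 x.2) (U ×ˢ Set.univ) →
      ∀ x ∈ U, Continuous (G x) := fun {G} hG x hx => by
    rw [← continuousOn_univ]
    exact hG.comp (f := fun q => (x, q)) (by fun_prop) fun q _ => ⟨hx, trivial⟩
  obtain ⟨K, hKs, hKU, hK⟩ : ∃ K ∈ 𝓝 s, K ⊆ U ∧ IsCompact K :=
    let ⟨K, hK, hK'⟩ := (Metric.nhds_basis_closedBall.mem_iff.1 (hU.mem_nhds hs))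
    ⟨_, Metric.closedBall_mem_nhds s hK, hK', isCompact_closedBall s K⟩
  obtain ⟨B, hB⟩ := (hK.prod hS).exists_bound_of_continuousOn
    (hF'.mono (Set.prod_mono hKU (Set.subset_univ S)))
  have hSm : MeasurableSet S := hS.measurableSet
  refine (hasDerivAt_integral_of_dominated_loc_of_deriv_le (bound := S.indicator fun _ => B)
    hKs ?_ ?_ (hcont hF' s hs).aestronglyMeasurable ?_ ?_ ?_).2
  · filter_upwards [hU.mem_nhds hs] with x hx
    exact (hcont hF x hx).aestronglyMeasurable
  · exact (hcont hF s hs).integrable_of_hasCompactSupport (HasCompactSupport.intro hS (hFS s))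
  · refine Eventually.of_forall fun q x hx => ?_
    by_cases hq : q ∈ S
    · rw [Set.indicator_of_mem hq]; exact hB (x, q) ⟨hx, hq⟩
    · rw [Set.indicator_of_notMem hq, hFS' x q hq, norm_zero]
  · exact (integrable_indicator_iff hSm).2 (integrableOn_const hS.measure_lt_top.ne)
  · exact Eventually.of_forall fun q x hx => hd x (hKU hx) q

/-- Green's formula on the line against a compactly supported function. -/
theorem integral_mul_second_deriv_eq {φ φ₁ φ₂ u u₁ u₂ : ℝ → ℂ}
    (hφ : ∀ q, HasDerivAt φ (φ₁ q) q) (hφ₁ : ∀ q, HasDerivAt φ₁ (φ₂ q) q)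
    (hu : ∀ q, HasDerivAt u (u₁ q) q) (hu₁ : ∀ q, HasDerivAt u₁ (u₂ q) q)
    (hφ₂ : Continuous φ₂) (hu₂ : Continuous u₂) {S : Set ℝ} (hS : IsCompact S)
    (h0 : ∀ q ∉ S, φ q = 0) (h1 : ∀ q ∉ S, φ₁ q = 0) (h2 : ∀ q ∉ S, φ₂ q = 0) :
    ∫ q, φ q * u₂ q = ∫ q, φ₂ q * u q := by
  have cφ : Continuous φ := continuous_iff_continuousAt.2 fun q => (hφ q).continuousAt
  have cφ₁ : Continuous φ₁ := continuous_iff_continuousAt.2 fun q => (hφ₁ q).continuousAt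
  have cu : Continuous u := continuous_iff_continuousAt.2 fun q => (hu q).continuousAt
  have cu₁ : Continuous u₁ := continuous_iff_continuousAt.2 fun q => (hu₁ q).continuousAt
  have hint : ∀ {ψ z : ℝ → ℂ}, Continuous ψ → Continuous z → (∀ q ∉ S, ψ q = 0) →
      Integrable (ψ * z) := fun {ψ z} hψ hz hψ0 =>
    (hψ.mul hz).integrable_of_hasCompactSupport (HasCompactSupport.intro hS fun q hq => by
      simp [hψ0 q hq])
  rw [integral_mul_deriv_eq_deriv_mul_of_integrable (fun q _ => hφ q) (fun q _ => hu₁ q)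
    (hint cφ hu₂ h0) (hint cφ₁ cu₁ h1) (hint cφ cu₁ h0),
    integral_mul_deriv_eq_deriv_mul_of_integrable (fun q _ => hφ₁ q) (fun q _ => hu q)
    (hint cφ₁ cu₁ h1) (hint hφ₂ cu h2) (hint cφ₁ cu h1), neg_neg]

namespace IsSolution

variable {ħ σ γ η : ℝ} {r : ENNReal} {w₀ : ℝ → ℂ} {w : ℝ → ℝ → ℂ}

theorem hasDerivAt_space (hw : IsSolution ħ σ γ η r w₀ w) {t : ℝ} (ht : 0 < t) (p : ℝ) :
    HasDerivAt (w t) (deriv (w t) p) p :=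
  ((hw.contDiff_space t ht).differentiable (by norm_num) p).hasDerivAt

theorem hasDerivAt_deriv_space (hw : IsSolution ħ σ γ η r w₀ w) {t : ℝ} (ht : 0 < t) (p : ℝ) :
    HasDerivAt (deriv (w t)) (iteratedDeriv 2 (w t) p) p := by
  rw [iteratedDeriv_succ, iteratedDeriv_one]
  have h := hw.contDiff_space t ht
  rw [show (2 : WithTop ℕ∞) = 1 + 1 by norm_num, contDiff_succ_iff_deriv] at h
  exact (h.2.2.differentiable (by norm_num) p).hasDerivAt

theorem continuous_slice {G : ℝ → ℝ → ℂ}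
    (hG : ContinuousOn (fun x : ℝ × ℝ => G x.1 x.2) (Set.Ioi 0 ×ˢ Set.univ)) {t : ℝ}
    (ht : 0 < t) : Continuous (G t) := by
  rw [← continuousOn_univ]
  exact hG.comp (f := fun q => (t, q)) (by fun_prop) fun q _ => ⟨ht, trivial⟩

theorem deriv_time (hħ : ħ ≠ 0) (hw : IsSolution ħ σ γ η r w₀ w) {t : ℝ} (ht : 0 < t) (p : ℝ) :
    deriv (fun s => w s p) t = ((ħ * σ ^ 2 / 2 : ℝ) : ℂ) * iteratedDeriv 2 (w t) p +
      (-((γ ^ 2 * η ^ 2 / (2 * ħ) * p ^ 2 : ℝ) : ℂ) + Complex.I * ((η / ħ * p : ℝ) : ℂ)) *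
        w t p := by
  have hħ' : (ħ : ℂ) ≠ 0 := by exact_mod_cast hħ
  have h := hw.equation t ht p
  have hI : Complex.I * (ħ : ℂ) ≠ 0 := mul_ne_zero Complex.I_ne_zero hħ'
  apply mul_left_cancel₀ hI
  rw [h]
  push_cast
  field_simp
  ring_nf
  rw [Complex.I_sq]
  ring

end IsSolution

section Uniqueness

variable {ħ σ γ η : ℝ} {r : ENNReal} {w₀ : ℝ → ℂ} {w : ℝ → ℝ → ℂ} {α b c d : ℝ → ℝ}

/-- The pairing of a solution with the backward kernel, truncated by a cutoff, has a derivative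
that involves only derivatives of the cutoff. -/
theorem hasDerivAt_integral_cutoff
    (h : MehlerCoefficients (ħ * σ ^ 2 / 2) (γ ^ 2 * η ^ 2 / (2 * ħ)) (η / ħ) α b c d)
    (hħ : ħ ≠ 0) (hw : IsSolution ħ σ γ η r w₀ w) {χ χ₁ χ₂ : ℝ → ℝ}
    (hχ : ∀ q, HasDerivAt χ (χ₁ q) q) (hχ₁ : ∀ q, HasDerivAt χ₁ (χ₂ q) q) (hχ₂ : Continuous χ₂)
    {S : Set ℝ} (hS : IsCompact S) (h0 : ∀ q ∉ S, χ q = 0) (h1 : ∀ q ∉ S, χ₁ q = 0)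
    (h2 : ∀ q ∉ S, χ₂ q = 0) {T s : ℝ} (hs : s ∈ Set.Ioo 0 T) (P : ℝ) :
    HasDerivAt (fun s => ∫ q, (χ q : ℂ) * (mehlerKernel α b c d (T - s) P q * w s q))
      (((ħ * σ ^ 2 / 2 : ℝ) : ℂ) * ∫ q, ((χ₂ q : ℂ) * mehlerKernel α b c d (T - s) P q +
        2 * (χ₁ q : ℂ) * mehlerKernelD α b c d (T - s) q P) * w s q) s := by
  have cχ : Continuous χ := continuous_iff_continuousAt.2 fun q => (hχ q).continuousAt
  have cχ₁ : Continuous χ₁ := continuous_iff_continuousAt.2 fun q => (hχ₁ q).continuousAt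
  have hmaps : Set.MapsTo (fun x : ℝ × ℝ => (T - x.1, x.2, P)) (Set.Ioo 0 T ×ˢ Set.univ)
      (Set.Ioi 0 ×ˢ Set.univ) := fun x hx => ⟨sub_pos.2 hx.1.2, trivial⟩
  have hsub : (Set.Ioo 0 T ×ˢ Set.univ : Set (ℝ × ℝ)) ⊆ Set.Ioi 0 ×ˢ Set.univ :=
    Set.prod_mono (fun x hx => hx.1) subset_rfl
  have cK := h.continuousOn_mehlerKernel.comp (by fun_prop) hmaps
  have cKT := h.continuousOn_mehlerKernelT.comp (by fun_prop) hmaps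
  have cw := hw.continuousOn.mono hsub
  have cwt := hw.continuousOn_deriv_time.mono hsub
  have cχ' : ContinuousOn (fun x : ℝ × ℝ => (χ x.2 : ℂ)) (Set.Ioo 0 T ×ˢ Set.univ) :=
    (Complex.continuous_ofReal.comp (cχ.comp continuous_snd)).continuousOn
  have key := hasDerivAt_integral_of_compact_support
    (F := fun s q => (χ q : ℂ) * (mehlerKernel α b c d (T - s) q P * w s q))
    (F' := fun s q => (χ q : ℂ) * (-mehlerKernelT (ħ * σ ^ 2 / 2) (γ ^ 2 * η ^ 2 / (2 * ħ)) (η / ħ)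
      α b c d (T - s) q P * w s q + mehlerKernel α b c d (T - s) q P * deriv (fun s => w s q) s))
    hS isOpen_Ioo (cχ'.mul (cK.mul cw)) (cχ'.mul ((cKT.neg.mul cw).add (cK.mul cwt)))
    (fun s q hq => by simp [h0 q hq]) (fun s q hq => by simp [h0 q hq])
    (fun s hs q => by
      have e1 : HasDerivAt (fun s => T - s) (-1) s := by
        simpa using (hasDerivAt_id s).const_sub T
      have e2 := (h.hasDerivAt_mehlerKernel_time (sub_pos.2 hs.2) q P).scomp s e1
      have e3 := (e2.mul (hw.differentiableAt_time s hs.1 q).hasDerivAt).const_mul (χ q : ℂ)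
      refine e3.congr_deriv ?_
      simp) hs
  -- By symmetry q moves to the first space slot, where the derivatives of the kernel are known.
  simp only [mehlerKernel_symm (T - _) P]
  refine key.congr_deriv ?_
  have hs0 := hs.1
  have hTs : 0 < T - s := sub_pos.2 hs.2
  have ckD : Continuous fun q => mehlerKernelD α b c d (T - s) q P :=
    continuous_iff_continuousAt.2 fun q => (hasDerivAt_mehlerKernelD (T - s) q P).continuousAt
  have ck : Continuous fun q => mehlerKernel α b c d (T - s) q P :=
    continuous_iff_continuousAt.2 fun q => (hasDerivAt_mehlerKernel (T - s) q P).continuousAt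
  have ckDD : Continuous fun q => mehlerKernelDD α b c d (T - s) q P := by
    rw [← continuousOn_univ]
    exact h.continuousOn_mehlerKernelDD.comp (f := fun q => (T - s, q, P)) (by fun_prop)
      fun q _ => ⟨hTs, trivial⟩
  have cws : Continuous (w s) := (hw.contDiff_space s hs0).continuous
  have cw2 : Continuous (iteratedDeriv 2 (w s)) :=
    IsSolution.continuous_slice (G := fun t => iteratedDeriv 2 (w t))
      hw.continuousOn_deriv_space_two hs0
  have hO : Continuous (fun x : ℝ => (x : ℂ)) := Complex.continuous_ofReal
  have green := integral_mul_second_deriv_eq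
    (φ := fun q => (χ q : ℂ) * mehlerKernel α b c d (T - s) q P)
    (fun q => (hχ q).ofReal_comp.mul (hasDerivAt_mehlerKernel (T - s) q P))
    (fun q => ((hχ₁ q).ofReal_comp.mul (hasDerivAt_mehlerKernel (T - s) q P)).add
      ((hχ q).ofReal_comp.mul (hasDerivAt_mehlerKernelD (T - s) q P)))
    (hw.hasDerivAt_space hs0) (hw.hasDerivAt_deriv_space hs0) (by fun_prop) cw2 hS
    (fun q hq => by simp [h0 q hq]) (fun q hq => by simp [h0 q hq, h1 q hq])
    (fun q hq => by simp [h0 q hq, h1 q hq, h2 q hq])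
  have hint : ∀ {ψ : ℝ → ℝ} {z : ℝ → ℂ}, Continuous ψ → Continuous z → (∀ q ∉ S, ψ q = 0) →
      Integrable (fun q => (ψ q : ℂ) * z q) := fun {ψ z} hψ hz hψ0 =>
    ((hO.comp hψ).mul hz).integrable_of_hasCompactSupport (HasCompactSupport.intro hS fun q hq => by
      simp [hψ0 q hq])
  -- The pairing is bilinear, without conjugation, so the potential terms cancel, the imaginary one
  -- included; only the second derivatives remain.
  have e1 : ∀ q, (χ q : ℂ) * (-mehlerKernelT (ħ * σ ^ 2 / 2) (γ ^ 2 * η ^ 2 / (2 * ħ)) (η / ħ)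
      α b c d (T - s) q P * w s q + mehlerKernel α b c d (T - s) q P * deriv (fun s => w s q) s) =
      ((ħ * σ ^ 2 / 2 : ℝ) : ℂ) * ((χ q : ℂ) * mehlerKernel α b c d (T - s) q P *
        iteratedDeriv 2 (w s) q - (χ q : ℂ) * (mehlerKernelDD α b c d (T - s) q P * w s q)) := by
    intro q
    rw [hw.deriv_time hħ hs0 q, mehlerKernelT]
    ring
  simp only [e1]
  rw [integral_const_mul]
  congr 1
  rw [integral_sub, green, ← integral_sub]
  · refine integral_congr_ae (Eventually.of_forall fun q => ?_)
    ring
  · exact Continuous.integrable_of_hasCompactSupport (by fun_prop)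
      (HasCompactSupport.intro hS fun q hq => by simp [h0 q hq, h1 q hq, h2 q hq])
  · exact hint cχ (ckDD.mul cws) h0
  · simpa only [mul_assoc, Pi.mul_apply] using hint cχ (ck.mul cw2) h0
  · exact hint cχ (ckDD.mul cws) h0

end Uniqueness

/-- A smooth cutoff at scale `R` with first and second derivatives `O(1/R)`. -/
theorem exists_cutoff : ∃ χ χ₁ χ₂ : ℝ → ℝ → ℝ, ∃ M : ℝ, 0 ≤ M ∧
    (∀ R ≥ 1, (∀ q, HasDerivAt (χ R) (χ₁ R q) q) ∧ (∀ q, HasDerivAt (χ₁ R) (χ₂ R q) q) ∧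
      Continuous (χ₂ R) ∧ ∃ S : Set ℝ, IsCompact S ∧ (∀ q ∉ S, χ R q = 0) ∧
        (∀ q ∉ S, χ₁ R q = 0) ∧ ∀ q ∉ S, χ₂ R q = 0) ∧
    (∀ R ≥ 1, ∀ q, |χ R q| ≤ 1 ∧ |χ₁ R q| ≤ M / R ∧ |χ₂ R q| ≤ M / R) ∧
    ∀ q, ∀ᶠ R in atTop, χ R q = 1 := by
  let f : ContDiffBump (0 : ℝ) := ⟨1, 2, one_pos, one_lt_two⟩
  have hf : ContDiff ℝ ∞ f := f.contDiff
  have hf1 : ContDiff ℝ ∞ (deriv f) := (contDiff_infty_iff_deriv.1 hf).2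
  have hf2 : ContDiff ℝ ∞ (deriv (deriv f)) := (contDiff_infty_iff_deriv.1 hf1).2
  have hc : HasCompactSupport f := f.hasCompactSupport
  obtain ⟨M₁, hM₁⟩ := hc.deriv.exists_bound_of_continuous hf1.continuous
  obtain ⟨M₂, hM₂⟩ := hc.deriv.deriv.exists_bound_of_continuous hf2.continuous
  have hM0 : 0 ≤ max M₁ M₂ := le_max_of_le_left ((norm_nonneg _).trans (hM₁ 0))
  have hdiv : ∀ R q : ℝ, HasDerivAt (fun q : ℝ => q / R) R⁻¹ q := fun R q => by
    simpa using (hasDerivAt_id q).div_const R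
  refine ⟨fun R q => f (q / R), fun R q => deriv f (q / R) * R⁻¹,
    fun R q => deriv (deriv f) (q / R) * R⁻¹ * R⁻¹, max M₁ M₂, hM0, fun R hR => ⟨fun q => ?_,
    fun q => ?_, ?_, (fun x => R * x) '' tsupport f, hc.image (by fun_prop), ?_⟩,
    fun R hR q => ?_, fun q => ?_⟩
  · exact (hf.differentiable (by simp) _).hasDerivAt.comp q (hdiv R q)
  · exact ((hf1.differentiable (by simp) _).hasDerivAt.comp q (hdiv R q)).mul_const _
  · have := hf2.continuous
    fun_prop
  · have hR0 : R ≠ 0 := by linarith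
    have hn : ∀ q, q ∉ (fun x => R * x) '' tsupport f → q / R ∉ tsupport f := fun q hq hq' =>
      hq ⟨q / R, hq', by field_simp⟩
    refine ⟨fun q hq => image_eq_zero_of_notMem_tsupport (hn q hq), fun q hq => ?_, fun q hq => ?_⟩
    · have := image_eq_zero_of_notMem_tsupport (fun h => hn q hq (tsupport_deriv_subset h))
      simp [this]
    · have := image_eq_zero_of_notMem_tsupport
        (fun h => hn q hq (tsupport_deriv_subset (tsupport_deriv_subset h)))
      simp [this]
  · have hR0 : 0 < R := by linarith
    have hRi : R⁻¹ ≤ 1 := inv_le_one_of_one_le₀ hR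
    have hRi0 : 0 < R⁻¹ := inv_pos.2 hR0
    refine ⟨?_, ?_, ?_⟩
    · rw [abs_of_nonneg f.nonneg]; exact f.le_one
    · rw [abs_mul, abs_of_pos hRi0, div_eq_mul_inv]
      exact mul_le_mul_of_nonneg_right ((hM₁ _).trans (le_max_left _ _)) hRi0.le
    -- The second derivative carries R⁻², weakened to R⁻¹ by R ≥ 1.
    · rw [abs_mul, abs_mul, abs_of_pos hRi0, div_eq_mul_inv]
      refine (mul_le_of_le_one_right (by positivity) hRi).trans ?_
      exact mul_le_mul_of_nonneg_right ((hM₂ _).trans (le_max_right _ _)) hRi0.le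
  · filter_upwards [eventually_ge_atTop (max 1 |q|)] with R hR
    have hR0 : 0 < R := by linarith [le_max_left 1 |q|]
    refine f.one_of_mem_closedBall ?_
    rw [mem_closedBall_zero_iff, norm_div, Real.norm_of_nonneg hR0.le, Real.norm_eq_abs]
    exact (div_le_one hR0).2 ((le_max_right _ _).trans hR)

section Uniqueness

variable {ħ σ γ η : ℝ} {r : ENNReal} {w₀ : ℝ → ℂ} {w : ℝ → ℝ → ℂ} {α b c d : ℝ → ℝ}

/-- The pairing of a solution with the backward kernel is constant in time. -/
theorem integral_backward_kernel_const
    (h : MehlerCoefficients (ħ * σ ^ 2 / 2) (γ ^ 2 * η ^ 2 / (2 * ħ)) (η / ħ) α b c d)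
    (hħ : ħ ≠ 0) (hr : 1 ≤ r) (hw : IsSolution ħ σ γ η r w₀ w) {T s₁ s₂ : ℝ}
    (hs₁ : s₁ ∈ Set.Ioo 0 T) (hs₂ : s₂ ∈ Set.Ioo 0 T) (P : ℝ) :
    ∫ q, mehlerKernel α b c d (T - s₁) P q * w s₁ q =
      ∫ q, mehlerKernel α b c d (T - s₂) P q * w s₂ q := by
  wlog hle : s₁ ≤ s₂ generalizing s₁ s₂
  · exact (this hs₂ hs₁ (not_le.1 hle).le).symm
  obtain ⟨χ, χ₁, χ₂, M, hM, hχ, hχb, hχlim⟩ := exists_cutoff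
  obtain ⟨C, β, hC0, hβ, hC⟩ := h.exists_gaussian_bound (T - s₁) |P| (sub_pos.2 hs₂.2)
  obtain ⟨Cβ, hCβ0, hCβ⟩ := exists_integral_gaussian_mul_norm_le hβ hr
  obtain ⟨W, hW⟩ := hw.bounded T
  have hmem : ∀ {s}, s ∈ Set.Icc s₁ s₂ → s ∈ Set.Ioo 0 T := fun {s} hs =>
    ⟨hs₁.1.trans_le hs.1, hs.2.trans_lt hs₂.2⟩
  have hmem' : ∀ {s}, s ∈ Set.Icc s₁ s₂ → T - s ∈ Set.Icc (T - s₂) (T - s₁) := fun {s} hs =>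
    ⟨sub_le_sub_left hs.2 T, sub_le_sub_left hs.1 T⟩
  have hWr : ∀ s ∈ Set.Icc s₁ s₂, ∫ q, Real.exp (-β * q ^ 2) * ‖w s q‖ ≤ Cβ * W := by
    intro s hs
    refine (hCβ _ (hw.memLp s (hmem hs).1)).trans ?_
    gcongr
    exact ENNReal.toReal_le_coe_of_le_coe (hW s ⟨(hmem hs).1, (hmem hs).2.le⟩)
  set D : ℝ := ħ * σ ^ 2 / 2 with hD
  set J : ℝ → ℝ → ℂ := fun R s =>
    ∫ q, (χ R q : ℂ) * (mehlerKernel α b c d (T - s) P q * w s q) with hJ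
  -- Mean value inequality in time. The 3 is 1 + 2, from the terms χ₂K and 2χ₁K'; the backward time
  -- stays in [T - s₂, T - s₁], away from 0, so one Gaussian bound suffices.
  have hJbound : ∀ R ≥ 1, ‖J R s₂ - J R s₁‖ ≤ |D| * (3 * C * M * (Cβ * W)) * (s₂ - s₁) * R⁻¹ := by
    intro R hR
    have hR0 : 0 < R := by linarith
    obtain ⟨d1, d2, d3, S, hS, z0, z1, z2⟩ := hχ R hR
    have hder : ∀ s ∈ Set.Icc s₁ s₂, HasDerivWithinAt (J R) _ (Set.Icc s₁ s₂) s := fun s hs =>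
      (hasDerivAt_integral_cutoff h hħ hw d1 d2 d3 hS z0 z1 z2 (hmem hs) P).hasDerivWithinAt
    have hle' := (convex_Icc s₁ s₂).norm_image_sub_le_of_norm_hasDerivWithin_le
      (C := |D| * (3 * C * M * (Cβ * W)) * R⁻¹) hder ?_ (Set.left_mem_Icc.2 hle)
      (Set.right_mem_Icc.2 hle)
    · refine hle'.trans_eq ?_
      rw [Real.norm_of_nonneg (sub_nonneg.2 hle)]
      ring
    · intro s hs
      rw [norm_mul, Complex.norm_real, Real.norm_eq_abs, mul_assoc |D|]
      gcongr
      have hint := (integrable_gaussian_mul hβ hr (hw.memLp s (hmem hs).1)).const_mul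
        (3 * C * M * R⁻¹)
      calc ‖∫ q, ((χ₂ R q : ℂ) * mehlerKernel α b c d (T - s) P q +
              2 * (χ₁ R q : ℂ) * mehlerKernelD α b c d (T - s) q P) * w s q‖
          ≤ ∫ q, 3 * C * M * R⁻¹ * (Real.exp (-β * q ^ 2) * ‖w s q‖) := by
            refine norm_integral_le_of_norm_le hint (Eventually.of_forall fun q => ?_)
            obtain ⟨k1, -, k2, -, -⟩ := hC (T - s) (hmem' hs) P le_rfl q
            obtain ⟨-, b1, b2⟩ := hχb R hR q
            rw [norm_mul, ← mul_assoc]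
            gcongr
            calc _ ≤ ‖(χ₂ R q : ℂ) * mehlerKernel α b c d (T - s) P q‖ +
                  ‖2 * (χ₁ R q : ℂ) * mehlerKernelD α b c d (T - s) q P‖ := norm_add_le _ _
              _ = |χ₂ R q| * ‖mehlerKernel α b c d (T - s) P q‖ +
                  2 * |χ₁ R q| * ‖mehlerKernelD α b c d (T - s) q P‖ := by
                rw [norm_mul, norm_mul, norm_mul, Complex.norm_real, Complex.norm_real,
                  Complex.norm_ofNat, Real.norm_eq_abs, Real.norm_eq_abs]
              _ ≤ M / R * (C * Real.exp (-β * q ^ 2)) +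
                  2 * (M / R) * (C * Real.exp (-β * q ^ 2)) := by gcongr
              _ = _ := by rw [div_eq_mul_inv]; ring
        _ ≤ 3 * C * M * R⁻¹ * (Cβ * W) := by
            rw [integral_const_mul]
            have := hWr s hs
            gcongr
        _ = _ := by ring
  have hlim : ∀ s ∈ Set.Icc s₁ s₂, Tendsto (fun R => J R s) atTop
      (𝓝 (∫ q, mehlerKernel α b c d (T - s) P q * w s q)) := by
    intro s hs
    have hTs : 0 < T - s := sub_pos.2 (hmem hs).2
    have hint := h.gaussianDominated.integrable hr (hw.memLp s (hmem hs).1) hTs P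
    refine tendsto_integral_filter_of_dominated_convergence _ ?_ ?_ hint.norm ?_
    · filter_upwards [eventually_ge_atTop 1] with R hR
      have : Continuous (χ R) :=
        continuous_iff_continuousAt.2 fun q => ((hχ R hR).1 q).continuousAt
      exact (Complex.continuous_ofReal.comp this).aestronglyMeasurable.mul hint.1
    · filter_upwards [eventually_ge_atTop 1] with R hR
      refine Eventually.of_forall fun q => ?_
      rw [norm_mul, Complex.norm_real]
      exact mul_le_of_le_one_left (norm_nonneg _) (hχb R hR q).1
    · refine Eventually.of_forall fun q => tendsto_const_nhds.congr' ?_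
      filter_upwards [hχlim q] with R hR
      rw [hR, Complex.ofReal_one, one_mul]
  have h0 : Tendsto (fun R => ‖J R s₂ - J R s₁‖) atTop (𝓝 0) := by
    refine squeeze_zero' (Eventually.of_forall fun _ => norm_nonneg _)
      ((eventually_ge_atTop 1).mono hJbound) ?_
    simpa using (tendsto_inv_atTop_zero (𝕜 := ℝ)).const_mul
      (|D| * (3 * C * M * (Cβ * W)) * (s₂ - s₁))
  have h1 := ((hlim s₂ (Set.right_mem_Icc.2 hle)).sub (hlim s₁ (Set.left_mem_Icc.2 hle))).norm
  exact (sub_eq_zero.1 (norm_eq_zero.1 (tendsto_nhds_unique h1 h0))).symm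

/-- As T - s stays in [T/2, T], one Gaussian bound controls the error of replacing w(s, ·) by w₀
through their L^r distance; continuity of the evolution in time does the rest. -/
theorem tendsto_integral_backward_kernel_zero
    (h : MehlerCoefficients (ħ * σ ^ 2 / 2) (γ ^ 2 * η ^ 2 / (2 * ħ)) (η / ħ) α b c d)
    (hr : 1 ≤ r) (hw₀ : MemLp w₀ r volume) (hw : IsSolution ħ σ γ η r w₀ w) {T : ℝ}
    (hT : 0 < T) (P : ℝ) :
    Tendsto (fun s => ∫ q, mehlerKernel α b c d (T - s) P q * w s q) (𝓝[>] 0)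
      (𝓝 (∫ q, mehlerKernel α b c d T P q * w₀ q)) := by
  obtain ⟨C, β, hC0, hβ, hC⟩ := h.exists_gaussian_bound T |P| (half_pos hT)
  obtain ⟨Cβ, hCβ0, hCβ⟩ := exists_integral_gaussian_mul_norm_le hβ hr
  have hsmall : ∀ᶠ s in 𝓝[>] (0 : ℝ), 0 < s ∧ s ≤ T / 2 := by
    filter_upwards [self_mem_nhdsWithin, mem_nhdsWithin_of_mem_nhds (Iic_mem_nhds (half_pos hT))]
      with s h1 h2 using ⟨h1, h2⟩
  have hA : Tendsto (fun s => ∫ q, mehlerKernel α b c d (T - s) P q * w₀ q) (𝓝[>] 0)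
      (𝓝 (∫ q, mehlerKernel α b c d T P q * w₀ q)) := by
    have h1 : ContinuousAt (fun x : ℝ × ℝ => ∫ q, mehlerKernel α b c d x.1 x.2 q * w₀ q) (T, P) :=
      (h.gaussianDominated.continuousOn_integral hr hw₀).continuousAt
        (prod_mem_nhds (Ioi_mem_nhds hT) univ_mem)
    have h2 : Tendsto (fun s : ℝ => (T - s, P)) (𝓝[>] 0) (𝓝 (T, P)) := by
      have : Continuous (fun s : ℝ => (T - s, P)) := by fun_prop
      simpa using (this.tendsto 0).mono_left nhdsWithin_le_nhds
    have h3 := h1.tendsto.comp h2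
    simpa only [Function.comp_def] using h3
  have hB : Tendsto (fun s => (∫ q, mehlerKernel α b c d (T - s) P q * w s q) -
      ∫ q, mehlerKernel α b c d (T - s) P q * w₀ q) (𝓝[>] 0) (𝓝 0) := by
    have hn := (ENNReal.tendsto_toReal ENNReal.zero_ne_top).comp hw.initial
    refine squeeze_zero_norm' ?_ (by simpa using hn.const_mul (C * Cβ))
    filter_upwards [hsmall] with s hs
    have hTs : 0 < T - s := by linarith
    have hm : MemLp (fun q => w s q - w₀ q) r volume := (hw.memLp s hs.1).sub hw₀
    rw [← integral_sub (h.gaussianDominated.integrable hr (hw.memLp s hs.1) hTs P)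
      (h.gaussianDominated.integrable hr hw₀ hTs P)]
    simp only [← mul_sub]
    calc _ ≤ ∫ q, C * (Real.exp (-β * q ^ 2) * ‖w s q - w₀ q‖) := by
          refine norm_integral_le_of_norm_le ((integrable_gaussian_mul hβ hr hm).const_mul C)
            (Eventually.of_forall fun q => ?_)
          rw [norm_mul, ← mul_assoc]
          gcongr
          exact (hC (T - s) ⟨by linarith, by linarith⟩ P le_rfl q).1
      _ ≤ _ := by
          rw [integral_const_mul, mul_assoc]
          gcongr
          exact hCβ _ hm
  simpa using hB.add hA

/-- Away from the diagonal the kernel tends to zero, uniformly with Gaussian decay. -/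
theorem MehlerCoefficients.exists_off_diagonal_bound {D v e : ℝ}
    (h : MehlerCoefficients D v e α b c d) (P : ℝ) : ∃ κ : ℝ → ℝ, Tendsto κ (𝓝[>] 0) (𝓝 0) ∧
      ∀ᶠ t in 𝓝[>] 0, 0 ≤ κ t ∧ ∀ q, 1 < |q - P| →
        ‖mehlerKernel α b c d t P q‖ ≤ κ t * Real.exp (-(1 / 2) * q ^ 2) := by
  -- For b ≥ 1 and x = (P - q)² ≥ 1 one has √(b/π) ≤ b and bx ≥ b + x - 1, while x ≥ q²/2 - P².
  refine ⟨fun t => b t * Real.exp (-b t) * Real.exp (1 + P ^ 2), ?_, ?_⟩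
  · have := ((Real.tendsto_pow_mul_exp_neg_atTop_nhds_zero 1).comp h.tendsto_b).mul_const
      (Real.exp (1 + P ^ 2))
    simpa [Function.comp_def] using this
  · filter_upwards [h.tendsto_b.eventually_ge_atTop 1, self_mem_nhdsWithin] with t hb ht
    refine ⟨by positivity, fun q hq => ?_⟩
    have hα := h.α_nonneg t ht
    rw [norm_mehlerKernel, abs_of_nonneg hα, mul_assoc, mul_assoc, mul_assoc, ← Real.exp_add,
      ← Real.exp_add]
    refine (mul_le_of_le_one_left (by positivity) (h.α_le_one t ht)).trans ?_
    have h1 : √(b t / Real.pi) ≤ b t := by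
      rw [Real.sqrt_le_left (by linarith)]
      calc b t / Real.pi ≤ b t := div_le_self (by linarith) (by linarith [Real.pi_gt_three])
        _ ≤ b t ^ 2 := by nlinarith
    gcongr
    have h2 : 1 ≤ (P - q) ^ 2 := by
      rw [← sq_abs, abs_sub_comm]; nlinarith
    have h3 := mul_nonneg (h.c_nonneg t ht) (sq_nonneg (P + q))
    nlinarith [mul_nonneg (sub_nonneg.2 hb) (sub_nonneg.2 h2), sq_nonneg (2 * P - q)]

/-- Globally w is controlled only in L^r, so the integral is split at |q - P| = 1. Inside, w is
bounded and continuous and the normal average concentrates at P; outside, the kernel is uniformly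
small against a Gaussian. -/
theorem tendsto_integral_backward_kernel_final
    (h : MehlerCoefficients (ħ * σ ^ 2 / 2) (γ ^ 2 * η ^ 2 / (2 * ħ)) (η / ħ) α b c d)
    (hr : 1 ≤ r) (hw : IsSolution ħ σ γ η r w₀ w) {T : ℝ} (hT : 0 < T) (P : ℝ) :
    Tendsto (fun u => ∫ q, mehlerKernel α b c d u P q * w (T - u) q) (𝓝[>] 0) (𝓝 (w T P)) := by
  set B : Set ℝ := Metric.closedBall P 1
  have hBm : MeasurableSet B := Metric.isClosed_closedBall.measurableSet
  have hsmall : ∀ᶠ s in 𝓝[>] (0 : ℝ), 0 < s ∧ s ≤ T / 2 := by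
    filter_upwards [self_mem_nhdsWithin, mem_nhdsWithin_of_mem_nhds (Iic_mem_nhds (half_pos hT))]
      with s h1 h2 using ⟨h1, h2⟩
  have hnear : Tendsto (fun u => ∫ q, mehlerKernel α b c d u P q * B.indicator (w (T - u)) q)
      (𝓝[>] 0) (𝓝 (w T P)) := by
    obtain ⟨M, hM⟩ := ((isCompact_Icc (a := T / 2) (b := T)).prod
      (isCompact_closedBall P 1)).exists_bound_of_continuousOn (hw.continuousOn.mono
        (Set.prod_mono (fun x hx => (half_pos hT).trans_le hx.1) (Set.subset_univ _)))
    have hM0 : 0 ≤ M := (norm_nonneg _).trans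
      (hM (T, P) ⟨⟨by linarith, le_rfl⟩, Metric.mem_closedBall_self zero_le_one⟩)
    -- The limit is written as an average so that dominated convergence under the normal law
    -- applies.
    have e : w T P = ∫ _ : ℝ, w T P ∂(ProbabilityTheory.gaussianReal 0 1) := by simp
    rw [e]
    have key : Tendsto (fun u => ∫ y, mehlerWeight α b c d u P y *
        B.indicator (w (T - u)) (P - (√(2 * b u))⁻¹ * y) ∂(ProbabilityTheory.gaussianReal 0 1))
        (𝓝[>] 0) (𝓝 (∫ _ : ℝ, w T P ∂(ProbabilityTheory.gaussianReal 0 1))) := by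
      refine tendsto_integral_filter_of_dominated_convergence (fun _ => M) ?_ ?_
        (integrable_const M) (Eventually.of_forall fun y => ?_)
      · filter_upwards [hsmall] with u hu
        refine (Continuous.aestronglyMeasurable ((continuous_mehlerWeight u).comp
          (by fun_prop : Continuous fun y : ℝ => (P, y)))).mul
          (StronglyMeasurable.aestronglyMeasurable ?_)
        exact ((hw.contDiff_space (T - u) (by linarith)).continuous.stronglyMeasurable.indicator
          hBm).comp_measurable (by fun_prop)
      · filter_upwards [hsmall] with u hu
        refine Eventually.of_forall fun y => ?_
        rw [norm_mul]
        refine (mul_le_of_le_one_left (norm_nonneg _) (norm_mehlerWeight_le (h.α_nonneg u hu.1)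
          (h.α_le_one u hu.1) (h.c_nonneg u hu.1) P y)).trans ?_
        by_cases hq : P - (√(2 * b u))⁻¹ * y ∈ B
        · rw [Set.indicator_of_mem hq]
          exact hM (T - u, _) ⟨⟨by linarith, by linarith⟩, hq⟩
        · rw [Set.indicator_of_notMem hq, norm_zero]; exact hM0
      · have h1 : Tendsto (fun u => P - (√(2 * b u))⁻¹ * y) (𝓝[>] 0) (𝓝 P) := by
          simpa using (h.tendsto_inv_sqrt.mul_const y).const_sub P
        have h2 : Tendsto (fun u : ℝ => T - u) (𝓝[>] 0) (𝓝 T) := by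
          have : Continuous (fun u : ℝ => T - u) := by fun_prop
          simpa using (this.tendsto 0).mono_left nhdsWithin_le_nhds
        have h3 : ContinuousAt (fun x : ℝ × ℝ => w x.1 x.2) (T, P) :=
          hw.continuousOn.continuousAt (prod_mem_nhds (Ioi_mem_nhds hT) univ_mem)
        have h4 := (h.tendsto_mehlerWeight P y).mul (h3.tendsto.comp (h2.prodMk_nhds h1))
        rw [one_mul] at h4
        refine h4.congr' ?_
        filter_upwards [h1.eventually (Metric.closedBall_mem_nhds P one_pos)] with u hu
        simp only [Function.comp_apply]
        rw [Set.indicator_of_mem (show _ ∈ B from hu)]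
    refine key.congr' ?_
    filter_upwards [hsmall] with u hu
    rw [integral_mehlerKernel_mul (h.b_pos u hu.1)]
  have hfar : Tendsto (fun u => ∫ q, mehlerKernel α b c d u P q * Bᶜ.indicator (w (T - u)) q)
      (𝓝[>] 0) (𝓝 0) := by
    obtain ⟨κ, hκ, hκb⟩ := h.exists_off_diagonal_bound P
    obtain ⟨C, hC0, hC⟩ := exists_integral_gaussian_mul_norm_le (β := 1 / 2) (by norm_num) hr
    obtain ⟨W, hW⟩ := hw.bounded T
    refine squeeze_zero_norm' ?_ (by simpa using hκ.mul_const (C * W))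
    filter_upwards [hsmall, hκb] with u hu hκu
    have hTu : 0 < T - u := by linarith
    calc _ ≤ ∫ q, κ u * (Real.exp (-(1 / 2) * q ^ 2) * ‖w (T - u) q‖) := by
          refine norm_integral_le_of_norm_le
            ((integrable_gaussian_mul (by norm_num) hr (hw.memLp _ hTu)).const_mul _)
            (Eventually.of_forall fun q => ?_)
          by_cases hq : q ∈ B
          · rw [Set.indicator_of_notMem (by simpa using hq), mul_zero, norm_zero]
            exact mul_nonneg hκu.1 (by positivity)
          · rw [Set.indicator_of_mem (by simpa using hq), norm_mul, ← mul_assoc]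
            gcongr
            refine hκu.2 q ?_
            rw [Metric.mem_closedBall, Real.dist_eq, not_le] at hq
            exact hq
      _ ≤ κ u * (C * W) := by
          rw [integral_const_mul]
          refine mul_le_mul_of_nonneg_left ((hC _ (hw.memLp _ hTu)).trans ?_) hκu.1
          gcongr
          exact ENNReal.toReal_le_coe_of_le_coe (hW _ ⟨hTu, by linarith⟩)
  have hsum := hnear.add hfar
  rw [add_zero] at hsum
  refine hsum.congr' ?_
  filter_upwards [hsmall] with u hu
  have hm := hw.memLp (T - u) (by linarith)
  rw [← integral_add (h.gaussianDominated.integrable hr (hm.indicator hBm) hu.1 P)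
    (h.gaussianDominated.integrable hr (hm.indicator hBm.compl) hu.1 P)]
  refine integral_congr_ae (Eventually.of_forall fun q => ?_)
  simp only [← mul_add]
  rw [Set.indicator_self_add_compl_apply]

/-- Both endpoint limits equal the constant value of the pairing, represented by its value at s =
T/2. -/
theorem IsSolution.eq_mehlerEvolution
    (h : MehlerCoefficients (ħ * σ ^ 2 / 2) (γ ^ 2 * η ^ 2 / (2 * ħ)) (η / ħ) α b c d)
    (hħ : ħ ≠ 0) (hr : 1 ≤ r) (hw₀ : MemLp w₀ r volume) (hw : IsSolution ħ σ γ η r w₀ w) {T : ℝ}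
    (hT : 0 < T) (P : ℝ) : w T P = mehlerEvolution α b c d w₀ T P := by
  have hh : T / 2 ∈ Set.Ioo 0 T := ⟨half_pos hT, by linarith⟩
  have hIoo : Set.Ioo 0 T ∈ 𝓝[>] (0 : ℝ) := Ioo_mem_nhdsGT hT
  have h1 := tendsto_integral_backward_kernel_zero h hr hw₀ hw hT P
  have h2 := tendsto_integral_backward_kernel_final h hr hw hT P
  have e1 := tendsto_nhds_unique h1 (tendsto_const_nhds.congr' (by
    filter_upwards [hIoo] with s hs
    exact integral_backward_kernel_const h hħ hr hw hh hs P))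
  have e2 := tendsto_nhds_unique h2 (tendsto_const_nhds.congr' (by
    filter_upwards [hIoo] with u hu
    have := integral_backward_kernel_const h hħ hr hw hh
      (s₂ := T - u) ⟨sub_pos.2 hu.2, by linarith [hu.1]⟩ P
    rwa [sub_sub_cancel] at this))
  rw [e2]
  exact e1.symm

end Uniqueness

/-! ### Identification of the Weyl kernel with the Gaussian kernel. -/

theorem strictMono_effectiveTime (Ω : ℝ) : StrictMono (effectiveTime Ω) := by
  refine strictMono_of_deriv_pos fun t => ?_
  rw [(hasDerivAt_effectiveTime Ω t).deriv, ← mul_pow, omega_mul_effectiveTime]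
  have := Real.tanh_sq_lt_one (t * Ω / 2)
  nlinarith

theorem effectiveTime_pos (Ω : ℝ) {t : ℝ} (ht : 0 < t) : 0 < effectiveTime Ω t := by
  have := strictMono_effectiveTime Ω ht
  rwa [effectiveTime_zero_right] at this

theorem effectiveTime_le (Ω : ℝ) {t : ℝ} (ht : 0 ≤ t) : effectiveTime Ω t ≤ t := by
  have hd : ∀ t, HasDerivAt (fun t => t - effectiveTime Ω t) (Ω ^ 2 * effectiveTime Ω t ^ 2 / 4) t :=
    fun t => ((hasDerivAt_id t).sub (hasDerivAt_effectiveTime Ω t)).congr_deriv (by ring)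
  have hm : Monotone (fun t => t - effectiveTime Ω t) :=
    monotone_of_deriv_nonneg (fun t => (hd t).differentiableAt) fun t => by
      rw [(hd t).deriv]; positivity
  have := hm ht
  simp only [effectiveTime_zero_right, sub_zero] at this
  linarith

theorem amplitude_nonneg (ħ γ Ω t : ℝ) : 0 ≤ amplitude ħ γ Ω t :=
  mul_nonneg (inv_nonneg.2 (Real.cosh_pos _).le) (Real.exp_pos _).le

theorem amplitude_le_one {ħ : ℝ} (hħ : 0 < ħ) (γ Ω : ℝ) {t : ℝ} (ht : 0 ≤ t) :
    amplitude ħ γ Ω t ≤ 1 := by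
  refine mul_le_one₀ (inv_le_one_of_one_le₀ (Real.one_le_cosh _)) (Real.exp_pos _).le ?_
  rw [Real.exp_le_one_iff, neg_mul]
  exact neg_nonpos.2 (mul_nonneg (by positivity) (sub_nonneg.2 (effectiveTime_le Ω ht)))

/-- As b is a multiple of 1/τ and c, d are multiples of τ, their equations are the Riccati equation
rewritten, and bc, bd are constant in time. Positivity of τ and τ ≤ t for t > 0 give the sign
conditions and α ≤ 1. -/
theorem mehlerCoefficients {ħ σ γ : ℝ} (hħ : 0 < ħ) (hσ : σ ≠ 0) (hγ : γ ≠ 0) (η : ℝ) :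
    MehlerCoefficients (ħ * σ ^ 2 / 2) (γ ^ 2 * η ^ 2 / (2 * ħ)) (η / ħ)
      (amplitude ħ γ (σ * γ * η)) (fun t => (2 * ħ * σ ^ 2 * effectiveTime (σ * γ * η) t)⁻¹)
      (fun t => effectiveTime (σ * γ * η) t * (γ ^ 2 * η ^ 2 / (8 * ħ)))
      (fun t => effectiveTime (σ * γ * η) t * (η / (2 * ħ))) := by
  have hτ : ∀ t > 0, 0 < effectiveTime (σ * γ * η) t := fun t ht => effectiveTime_pos _ ht
  have hd := hasDerivAt_effectiveTime (σ * γ * η)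
  have hτ0 : Tendsto (effectiveTime (σ * γ * η)) (𝓝[>] 0) (𝓝 0) := by
    have := ((contDiff_effectiveTime (σ * γ * η)).continuous.tendsto 0).mono_left
      (nhdsWithin_le_nhds (s := Set.Ioi 0))
    rwa [effectiveTime_zero_right] at this
  refine ⟨fun t ht => ?_, fun t ht => ?_, fun t _ => amplitude_nonneg _ _ _ _,
    fun t ht => amplitude_le_one hħ _ _ (le_of_lt ht), fun t ht => ?_, fun t ht => ?_,
    fun t ht => ?_, fun t ht => ?_, fun t ht => ?_, fun t ht => ?_, ?_, ?_, ?_, ?_⟩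
  · have := hτ t ht
    positivity
  · have := hτ t ht
    positivity
  · have h1 := (hτ t ht).ne'
    refine (((hd t).const_mul (2 * ħ * σ ^ 2)).inv (by positivity)).congr_deriv ?_
    field_simp
    ring
  · refine ((hd t).mul_const _).congr_deriv ?_
    field_simp
    ring
  · refine ((hd t).mul_const _).congr_deriv ?_
    field_simp
    ring
  · refine (hasDerivAt_amplitude ħ γ (σ * γ * η) t).congr_deriv ?_
    field_simp
    ring
  · have h1 := (hτ t ht).ne'
    field_simp
    ring
  · have h1 := (hτ t ht).ne'
    field_simp
    ring
  · refine Tendsto.inv_tendsto_nhdsGT_zero (tendsto_nhdsWithin_iff.2 ⟨?_, ?_⟩)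
    · simpa using hτ0.const_mul (2 * ħ * σ ^ 2)
    · filter_upwards [self_mem_nhdsWithin] with t ht
      have := hτ t ht
      exact Set.mem_Ioi.2 (by positivity)
  · simpa using hτ0.mul_const (γ ^ 2 * η ^ 2 / (8 * ħ))
  · simpa using hτ0.mul_const (η / (2 * ħ))
  · have := ((contDiff_amplitude ħ γ (σ * γ * η)).continuous.tendsto 0).mono_left
      (nhdsWithin_le_nhds (s := Set.Ioi 0))
    simpa [amplitude, effectiveTime_zero_right] using this

/-- The oscillatory integrand of the Weyl kernel is a Gaussian in `ξ`. -/
theorem weylKernel_integrand_eq {ħ σ γ : ℝ} (hħ : 0 < ħ) (hσ : σ ≠ 0) (hγ : γ ≠ 0)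
    (η t p p' ξ : ℝ) :
    Complex.exp (Complex.I / (ħ : ℂ) * (((p - p') * ξ : ℝ) : ℂ)) *
      propagatorSymbol ħ σ γ η t ξ ((p + p') / 2) =
    (amplitude ħ γ (σ * γ * η) t : ℂ) * Complex.exp
      (-((effectiveTime (σ * γ * η) t * σ ^ 2 / (2 * ħ) : ℝ) : ℂ) * (ξ : ℂ) ^ 2 +
        Complex.I * (((p - p') / ħ : ℝ) : ℂ) * ξ +
        (((-(effectiveTime (σ * γ * η) t * (γ ^ 2 * η ^ 2 / (8 * ħ)) * (p + p') ^ 2) : ℝ) : ℂ) +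
          Complex.I * ((effectiveTime (σ * γ * η) t * (η / (2 * ħ)) * (p + p') : ℝ) : ℂ))) := by
  have hħ' : (ħ : ℂ) ≠ 0 := by exact_mod_cast hħ.ne'
  rw [propagatorSymbol_eq hσ hγ, mul_left_comm, ← Complex.exp_add, hamiltonian]
  congr 2
  push_cast
  field_simp
  ring_nf
  rw [Complex.I_sq]
  ring

/-- A Gaussian Fourier transform, legitimate because the coefficient τσ²/(2ħ) of -ξ² is positive for
t > 0. -/
theorem weylKernel_propagatorSymbol {ħ σ γ : ℝ} (hħ : 0 < ħ) (hσ : σ ≠ 0) (hγ : γ ≠ 0)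
    (η : ℝ) {t : ℝ} (ht : 0 < t) (p p' : ℝ) :
    weylKernel ħ (propagatorSymbol ħ σ γ η t) p p' =
      mehlerKernel (amplitude ħ γ (σ * γ * η))
        (fun t => (2 * ħ * σ ^ 2 * effectiveTime (σ * γ * η) t)⁻¹)
        (fun t => effectiveTime (σ * γ * η) t * (γ ^ 2 * η ^ 2 / (8 * ħ)))
        (fun t => effectiveTime (σ * γ * η) t * (η / (2 * ħ))) t p p' := by
  have hτ := effectiveTime_pos (σ * γ * η) ht
  simp only [weylKernel, weylKernel_integrand_eq hħ hσ hγ, mehlerKernel]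
  generalize effectiveTime (σ * γ * η) t = τ at hτ ⊢
  have hβ : 0 < τ * σ ^ 2 / (2 * ħ) := by positivity
  rw [integral_const_mul, integral_cexp_quadratic (by
    rw [Complex.neg_re, Complex.ofReal_re]; exact neg_lt_zero.2 hβ)]
  have e1 : (((-(τ * (γ ^ 2 * η ^ 2 / (8 * ħ)) * (p + p') ^ 2) : ℝ) : ℂ) +
      Complex.I * ((τ * (η / (2 * ħ)) * (p + p') : ℝ) : ℂ)) -
      (Complex.I * (((p - p') / ħ : ℝ) : ℂ)) ^ 2 / (4 * -((τ * σ ^ 2 / (2 * ħ) : ℝ) : ℂ)) =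
      ((-((2 * ħ * σ ^ 2 * τ)⁻¹ * (p - p') ^ 2) -
        τ * (γ ^ 2 * η ^ 2 / (8 * ħ)) * (p + p') ^ 2 : ℝ) : ℂ) +
      Complex.I * ((τ * (η / (2 * ħ)) * (p + p') : ℝ) : ℂ) := by
    have hħ' : (ħ : ℂ) ≠ 0 := by exact_mod_cast hħ.ne'
    have hσ' : (σ : ℂ) ≠ 0 := by exact_mod_cast hσ
    have hτ' : (τ : ℂ) ≠ 0 := by exact_mod_cast hτ.ne'
    rw [mul_pow, Complex.I_sq]
    push_cast
    field_simp
    ring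
  -- The complex power is the square root of a positive real; written through √(b/π) it carries the
  -- factor 2πħ that cancels the normalisation of the Weyl kernel.
  have e2 : ((Real.pi : ℂ) / - -((τ * σ ^ 2 / (2 * ħ) : ℝ) : ℂ)) ^ (1 / 2 : ℂ) =
      ((2 * Real.pi * ħ * √((2 * ħ * σ ^ 2 * τ)⁻¹ / Real.pi) : ℝ) : ℂ) := by
    rw [neg_neg, ← Complex.ofReal_div, show (1 / 2 : ℂ) = ((1 / 2 : ℝ) : ℂ) by norm_num,
      ← Complex.ofReal_cpow (by positivity), ← Real.sqrt_eq_rpow]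
    congr 1
    rw [Real.sqrt_eq_iff_mul_self_eq_of_pos (by positivity)]
    have hs := Real.mul_self_sqrt (show 0 ≤ (2 * ħ * σ ^ 2 * τ)⁻¹ / Real.pi by positivity)
    rw [mul_mul_mul_comm, hs]
    field_simp
  rw [e1, e2]
  have hħ' : (ħ : ℂ) ≠ 0 := by exact_mod_cast hħ.ne'
  have hπ : (Real.pi : ℂ) ≠ 0 := by exact_mod_cast Real.pi_ne_zero
  generalize Complex.exp _ = E
  generalize √((2 * ħ * σ ^ 2 * τ)⁻¹ / Real.pi) = s
  push_cast
  field_simp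

theorem integrable_weylKernel_integrand {ħ σ γ : ℝ} (hħ : 0 < ħ) (hσ : σ ≠ 0) (hγ : γ ≠ 0)
    (η : ℝ) {t : ℝ} (ht : 0 < t) (p p' : ℝ) :
    Integrable (fun ξ : ℝ => Complex.exp (Complex.I / (ħ : ℂ) * (((p - p') * ξ : ℝ) : ℂ)) *
      propagatorSymbol ħ σ γ η t ξ ((p + p') / 2)) := by
  have hτ := effectiveTime_pos (σ * γ * η) ht
  simp only [weylKernel_integrand_eq hħ hσ hγ]
  refine (integrable_cexp_quadratic ?_ _ _).const_mul _
  rw [Complex.ofReal_re]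
  positivity

/-- The explicit kernel is available only for t > 0. This is enough, since time derivatives at t > 0
are local and the initial condition is a limit from the right. -/
theorem IsSolution.congr {ħ σ γ η : ℝ} {r : ENNReal} {w₀ : ℝ → ℂ} {w w' : ℝ → ℝ → ℂ}
    (hw : IsSolution ħ σ γ η r w₀ w) (h : ∀ t > 0, w' t = w t) :
    IsSolution ħ σ γ η r w₀ w' := by
  have hev : ∀ t > 0, ∀ p, (fun s => w' s p) =ᶠ[𝓝 t] fun s => w s p := fun t ht p => by
    filter_upwards [Ioi_mem_nhds ht] with s hs
    rw [h s hs]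
  refine ⟨fun t ht p => ?_, fun t ht => ?_, ?_, ?_, ?_, ?_, fun t ht p => ?_, fun t ht => ?_,
    fun T => ?_, ?_⟩
  · exact (hw.differentiableAt_time t ht p).congr_of_eventuallyEq (hev t ht p)
  · rw [h t ht]; exact hw.contDiff_space t ht
  · exact hw.continuousOn.congr fun x hx => by rw [h x.1 hx.1]
  · exact hw.continuousOn_deriv_time.congr fun x hx => (hev x.1 hx.1 x.2).deriv_eq
  · exact hw.continuousOn_deriv_space.congr fun x hx => by simp only [h x.1 hx.1]
  · exact hw.continuousOn_deriv_space_two.congr fun x hx => by simp only [h x.1 hx.1]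
  · rw [(hev t ht p).deriv_eq, h t ht]; exact hw.equation t ht p
  · rw [h t ht]; exact hw.memLp t ht
  · obtain ⟨C, hC⟩ := hw.bounded T
    exact ⟨C, fun t ht => by rw [h t ht.1]; exact hC t ht⟩
  · refine hw.initial.congr' ?_
    filter_upwards [self_mem_nhdsWithin] with t ht
    rw [h t ht]

theorem isPropagator_weylKernel {ħ σ γ : ℝ} (hħ : 0 < ħ) (hσ : σ ≠ 0) (hγ : γ ≠ 0) (η : ℝ) :
    IsPropagator ħ σ γ η (fun t => weylKernel ħ (propagatorSymbol ħ σ γ η t)) := by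
  intro r hr hr' w₀ hw₀
  have h := mehlerCoefficients hħ hσ hγ η
  have hK : ∀ t > 0, ∀ p, ∫ p', weylKernel ħ (propagatorSymbol ħ σ γ η t) p p' * w₀ p' =
      mehlerEvolution _ _ _ _ w₀ t p := fun t ht p => by
    simp only [weylKernel_propagatorSymbol hħ hσ hγ η ht]
    rfl
  refine ⟨fun t ht p => ?_, ?_, fun w hw t ht p => ?_⟩
  · simp only [weylKernel_propagatorSymbol hħ hσ hγ η ht]
    exact h.gaussianDominated.integrable hr hw₀ ht p
  · exact (h.isSolution hħ.ne' hr hr' hw₀).congr fun t ht => funext (hK t ht)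
  · rw [hK t ht p]
    exact hw.eq_mehlerEvolution h hħ.ne' hr hw₀ ht p

end LindbladMehler

end

theorem mainTheorem2 (ħ σ γ : ℝ) (hħ : 0 < ħ) (hσ : σ ≠ 0) (hγ : γ ≠ 0) :
    -- the extension of the explicit symbol to `η = 0` is continuous, jointly in `(η, t, ξ, p)`
    Continuous (fun x : ℝ × ℝ × ℝ × ℝ =>
        LindbladMehler.propagatorSymbol ħ σ γ x.1 x.2.1 x.2.2.1 x.2.2.2) ∧
    ∀ η : ℝ,
      -- the symbol is smooth in `(t, ξ, p)`
      ContDiff ℝ ∞ (fun x : ℝ × ℝ × ℝ =>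
        LindbladMehler.propagatorSymbol ħ σ γ η x.1 x.2.1 x.2.2) ∧
      -- it solves `iħ ∂ₜA = H # A` with `A(0) = 1`
      (∀ ξ p : ℝ, LindbladMehler.propagatorSymbol ħ σ γ η 0 ξ p = 1) ∧
      (∀ t ξ p : ℝ,
        HasSum
          (fun n : ℕ => LindbladMehler.moyalTerm ħ (LindbladMehler.hamiltonian σ γ η)
            (LindbladMehler.propagatorSymbol ħ σ γ η t) n ξ p)
          (Complex.I * (ħ : ℂ) *
            deriv (fun s => LindbladMehler.propagatorSymbol ħ σ γ η s ξ p) t)) ∧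
      -- the kernel of its Weyl quantisation is an absolutely convergent integral and is the
      -- propagator of the transformed Lindblad equation
      (∀ t > 0, ∀ p p' : ℝ,
        Integrable (fun ξ : ℝ =>
          Complex.exp (Complex.I / (ħ : ℂ) * (((p - p') * ξ : ℝ) : ℂ)) *
            LindbladMehler.propagatorSymbol ħ σ γ η t ξ ((p + p') / 2)) volume) ∧
      LindbladMehler.IsPropagator ħ σ γ η
        (fun t => LindbladMehler.weylKernel ħ (LindbladMehler.propagatorSymbol ħ σ γ η t)) := by
  refine ⟨LindbladMehler.continuous_propagatorSymbol hσ hγ ħ, fun η =>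
    ⟨LindbladMehler.contDiff_propagatorSymbol hσ hγ ħ η,
      LindbladMehler.propagatorSymbol_zero hσ hγ ħ η,
      LindbladMehler.hasSum_moyalTerm_propagatorSymbol hħ hσ hγ η,
      fun t ht p p' => LindbladMehler.integrable_weylKernel_integrand hħ hσ hγ η ht p p',
      LindbladMehler.isPropagator_weylKernel hħ hσ hγ η⟩⟩
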